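/- Consider the Cauchy problem for the nonlinear massless Dirac system \[ i(u_t+u_x)=G_1(u,v),\qquad i(v_t-v_x)=G_2(u,v),\qquad (u,v)|_{t=0}=(u_0,v_0), \] for complex-valued functions $u,v$ of $x\in\mathbb R$, $t\ge 0$, where $G_1=\partial_{\overline u}W+F_1$ and $G_2=\partial_{\overline v}W+F_2$, $W:\mathbb C^2\to\mathbb R$ is a (real) polynomial in $|u|^2$ and $|v|^2$, and $F_1,F_2$ are polynomials of degree at most three in $u,v,\overline u,\overline v$ such that \[ |\overline u F_1(u,v)|+|\overline v F_2(u,v)|\le c\,|u|^2|v|^2\qquad\text{for all }(u,v)\in\mathbb C^2 \] for some constant $c>0$. Here $\partial_{\bar z}=\tfrac12(\partial_{\mathrm{Re}\,z}+i\,\partial_{\mathrm{Im}\,z})$, and functions in $H^1(\mathbb R)$ are identified with their continuous representatives. A global classical solution is a pair $(u,v)\in C([0,\infty);H^1(\mathbb R))\cap C^1([0,\infty);L^2(\mathbb R))$ which satisfies the equations in $L^2(\mathbb R)$ for every $t\ge 0$ and attains the initial data. **Proposition.** For every $c>0$ there are constants $\delta>0$ and $C_2>0$, depending only on $c$, such that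 the following holds for all $W,F_1,F_2$ as above and all $u_0,v_0\in H^1(\mathbb R)$ with $\|u_0\|_{L^2(\mathbb R)}+\|v_0\|_{L^2(\mathbb R)}\le\delta$. The Cauchy problem has a unique global classical solution $(u,v)$, and moreover $u,v\in L^\infty(\mathbb R\times[0,\infty))$. This solution satisfies \[ \sup_{t\ge 0,\;x\in\mathbb R}\big(|u(x,t)|^2+|v(x,t)|^2\big)\le C_2\sup_{x\in\mathbb R}\big(|u_0(x)|^2+|v_0(x)|^2\big), \] and, for all $a<b$ and all $t\ge 0$, \[ \int_a^b\big(|u(x,t)|^2+|v(x,t)|^2\big)\,dx\le C_2\int_a^b\big(|u_0(x-t)|^2+|v_0(x+t)|^2\big)\,dx . \] -/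

import Mathlib

open Set MeasureTheory

noncomputable section

namespace NonlinearDirac

/-- The Lebesgue space of square integrable complex functions on the real line. -/
abbrev L2 : Type := Lp ℂ 2 (volume : Measure ℝ)

/-- `g` is the weak derivative of `f`, tested against real smooth compactly supported functions. -/
def HasWeakDeriv (f g : L2) : Prop :=
  ∀ φ : ℝ → ℝ, ContDiff ℝ (⊤ : ℕ∞) φ → HasCompactSupport φ →
    ∫ x, deriv φ x • f x = - ∫ x, φ x • g x

theorem integrable_test_smul {φ : ℝ → ℝ} (hφ : Continuous φ) (hc : HasCompactSupport φ)
    (f : L2) : Integrable (fun x => φ x • f x) := by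
  have h1 : MemLp φ 2 (volume : Measure ℝ) := hφ.memLp_of_hasCompactSupport hc
  have h2 : MemLp (f : ℝ → ℂ) 2 (volume : Measure ℝ) := Lp.memLp f
  exact memLp_one_iff_integrable.mp (h2.smul h1)

theorem HasWeakDeriv.zero : HasWeakDeriv 0 0 := by
  intro φ _ _
  have h := Lp.coeFn_zero ℂ 2 (volume : Measure ℝ)
  rw [integral_congr_ae (g := fun _ => (0 : ℂ))
      (by filter_upwards [h] with x hx; rw [hx, Pi.zero_apply, smul_zero]),
    integral_congr_ae (f := fun x => φ x • (0 : L2) x) (g := fun _ => (0 : ℂ))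
      (by filter_upwards [h] with x hx; rw [hx, Pi.zero_apply, smul_zero])]
  simp

theorem HasWeakDeriv.add {f g f' g' : L2} (hf : HasWeakDeriv f f') (hg : HasWeakDeriv g g') :
    HasWeakDeriv (f + g) (f' + g') := by
  intro φ hφ hc
  have hd : Continuous (deriv φ) := hφ.continuous_deriv (by simp)
  rw [integral_congr_ae (g := fun x => deriv φ x • f x + deriv φ x • g x)
      (by filter_upwards [Lp.coeFn_add f g] with x hx; rw [hx, Pi.add_apply, smul_add]),
    integral_congr_ae (f := fun x => φ x • (f' + g') x) (g := fun x => φ x • f' x + φ x • g' x)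
      (by filter_upwards [Lp.coeFn_add f' g'] with x hx; rw [hx, Pi.add_apply, smul_add]),
    integral_add (integrable_test_smul hd hc.deriv f) (integrable_test_smul hd hc.deriv g),
    integral_add (integrable_test_smul hφ.continuous hc f')
      (integrable_test_smul hφ.continuous hc g'), hf φ hφ hc, hg φ hφ hc]
  ring

theorem HasWeakDeriv.smul (c : ℂ) {f f' : L2} (hf : HasWeakDeriv f f') :
    HasWeakDeriv (c • f) (c • f') := by
  intro φ hφ hc
  rw [integral_congr_ae (g := fun x => c • (deriv φ x • f x))
      (by filter_upwards [Lp.coeFn_smul c f] with x hx; rw [hx, Pi.smul_apply, smul_comm]),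
    integral_congr_ae (f := fun x => φ x • (c • f') x) (g := fun x => c • (φ x • f' x))
      (by filter_upwards [Lp.coeFn_smul c f'] with x hx; rw [hx, Pi.smul_apply, smul_comm]),
    integral_smul, integral_smul, hf φ hφ hc, smul_neg]

/-- The Sobolev space `H¹(ℝ)` of complex functions, realized as the space of pairs `(f, f')` of
square integrable functions such that `f'` is the weak derivative of `f`. The norm inherited from
the Hilbert sum is the usual one, `‖(f, f')‖² = ‖f‖² + ‖f'‖²`. -/
def H1 : Submodule ℂ (WithLp 2 (L2 × L2)) where
  carrier := {p | HasWeakDeriv p.fst p.snd}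
  zero_mem' := HasWeakDeriv.zero
  add_mem' := fun h₁ h₂ => HasWeakDeriv.add h₁ h₂
  smul_mem' := fun c _ h => HasWeakDeriv.smul c h

/-- The underlying `L²` function of an element of `H¹(ℝ)`. -/
def H1.toL2 (f : H1) : L2 := (f : WithLp 2 (L2 × L2)).fst

/-- The weak derivative of an element of `H¹(ℝ)`. -/
def H1.dx (f : H1) : L2 := (f : WithLp 2 (L2 × L2)).snd

/-- `f` is an `H¹(ℝ)` function. As usual in one space dimension, elements of `H¹(ℝ)` are identified
with their continuous representatives, so that pointwise values make sense. -/
def MemH1 (f : ℝ → ℂ) : Prop :=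
  Continuous f ∧ ∃ g : H1, f =ᵐ[volume] H1.toL2 g

/-- The Wirtinger derivative `∂f/∂z̄ = (∂f/∂x + i ∂f/∂y) / 2` of a function of `z = x + i y`. -/
def wirtingerBar (f : ℂ → ℂ) (z : ℂ) : ℂ :=
  (1 / 2 : ℂ) * (fderiv ℝ f z 1 + Complex.I * fderiv ℝ f z Complex.I)

/-- `W(u,v)` is a real-valued polynomial in the variables `|u|²` and `|v|²`. -/
def IsPolynomialInModuli (W : ℂ → ℂ → ℝ) : Prop :=
  ∃ P : MvPolynomial (Fin 2) ℝ, ∀ u v, W u v = MvPolynomial.eval ![‖u‖ ^ 2, ‖v‖ ^ 2] P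

/-- `F(u,v)` is a polynomial of degree at most three in `u`, `v` and their complex conjugates. -/
def IsCubicPolynomial (F : ℂ → ℂ → ℂ) : Prop :=
  ∃ P : MvPolynomial (Fin 4) ℂ, P.totalDegree ≤ 3 ∧
    ∀ u v, F u v = MvPolynomial.eval ![u, v, star u, star v] P

/-- The nonlinearity `G₁ = ∂W/∂ū + F₁`. -/
def G₁ (W : ℂ → ℂ → ℝ) (F₁ : ℂ → ℂ → ℂ) (u v : ℂ) : ℂ :=
  wirtingerBar (fun z => (W z v : ℂ)) u + F₁ u v

/-- The nonlinearity `G₂ = ∂W/∂v̄ + F₂`. -/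
def G₂ (W : ℂ → ℂ → ℝ) (F₂ : ℂ → ℂ → ℂ) (u v : ℂ) : ℂ :=
  wirtingerBar (fun z => (W u z : ℂ)) v + F₂ u v

/-- `w(t, ·)`, `t ≥ 0`, is the family of continuous representatives of a curve `U` belonging to
`C([0,∞); H¹(ℝ)) ∩ C¹([0,∞); L²(ℝ))` whose time derivative is `U'`. -/
structure IsH1Curve (w : ℝ → ℝ → ℂ) (U : ℝ → H1) (U' : ℝ → L2) : Prop where
  continuousOn_H1 : ContinuousOn U (Ici 0)
  hasDeriv_L2 : ∀ t ∈ Ici (0 : ℝ), HasDerivWithinAt (fun s => H1.toL2 (U s)) (U' t) (Ici 0) t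
  continuousOn_deriv : ContinuousOn U' (Ici 0)
  continuous_rep : ∀ t ∈ Ici (0 : ℝ), Continuous (w t)
  rep_ae_eq : ∀ t ∈ Ici (0 : ℝ), w t =ᵐ[volume] H1.toL2 (U t)

/-- `(u, v)` (with time as the first argument) is a global classical solution of
`i(u_t + u_x) = g₁(u,v)`, `i(v_t - v_x) = g₂(u,v)`, `(u,v) = (u₀,v₀)` at `t = 0`:
`u` and `v` belong to `C([0,∞); H¹) ∩ C¹([0,∞); L²)`, the equations hold for every time `t ≥ 0`
almost everywhere in `x`, and the initial values are attained. -/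
def IsGlobalClassicalSolution (g₁ g₂ : ℂ → ℂ → ℂ) (u₀ v₀ : ℝ → ℂ) (u v : ℝ → ℝ → ℂ) : Prop :=
  ∃ (U V : ℝ → H1) (U' V' : ℝ → L2),
    IsH1Curve u U U' ∧ IsH1Curve v V V' ∧
    (∀ t ∈ Ici (0 : ℝ), ∀ᵐ x : ℝ, Complex.I * (U' t x + H1.dx (U t) x) = g₁ (u t x) (v t x)) ∧
    (∀ t ∈ Ici (0 : ℝ), ∀ᵐ x : ℝ, Complex.I * (V' t x - H1.dx (V t) x) = g₂ (u t x) (v t x)) ∧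
    u 0 = u₀ ∧ v 0 = v₀

/-- The function `w` of time and space belongs to `L^∞([0,∞) × ℝ)`. -/
def MemLinfty (w : ℝ → ℝ → ℂ) : Prop :=
  MemLp (fun p : ℝ × ℝ => w p.1 p.2) ⊤ (volume.restrict (Ici (0 : ℝ) ×ˢ (univ : Set ℝ)))

end NonlinearDirac

end

open NonlinearDirac

noncomputable section

open scoped Topology ENNReal NNReal BoundedContinuousFunction

namespace NonlinearDirac

/-! In the moving frames `y = x - t` for `u` and `y = x + t` for `v` the transport terms disappear,
and the system becomes an ordinary differential equation in `H¹ × H¹`. The nonlinearities are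
polynomial and vanish at the origin, and `H¹(ℝ)` is an algebra, so they act on it as locally
Lipschitz maps with `‖N w‖ ≤ C(R) ‖w‖` whenever both components of `w` are bounded by `R` in sup
norm (`IsLift`). Global existence thus reduces to control of the sup norm.

That control comes from the structure of the system. The gradient part of the nonlinearity is a real
multiple of the component itself, so it drops out of the derivative of the densities `a = |u|²`, `b
= |v|²`; what remains is `a' ≤ 2c a b` along right-moving characteristics and the mirror inequality
for `b`. As long as the integral of `b` along a right-moving characteristic is at most `2μ`, with
`exp (4cμ) ≤ 2`, the density `a` at most doubles, and symmetrically for `b`. Since opposite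
characteristics cross at relative speed 2, doubling bounds these integrals by the initial masses,
hence by `μ`. So `2μ` improves to `μ` and the bootstrap closes (`transport_le_two_mul`), giving
`|u(t,x)|² ≤ 2|u₀(x-t)|²` and `|v(t,x)|² ≤ 2|v₀(x+t)|²`. Boundedness and both asserted estimates
follow at once.

Existence avoids a maximal-time argument. The field is truncated by rescaling both components with
one common factor in `(0, 1]`; the truncated equation is globally solvable and satisfies the same
density inequalities. The pointwise bound therefore does not depend on the truncation radius,
Gronwall bounds the `H¹` norm, and a radius chosen above that bound is never reached
(`exists_charSolution`). Uniqueness is Gronwall in `L²` in the moving frames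
(`IsGlobalClassicalSolution.unique`). Throughout, weak derivatives are handled as derivatives of the
translation group. -/

/-! ### Translations and weak derivatives in L². -/

/-- Translation by `s` on `L²(ℝ)`. -/
def shift (s : ℝ) : L2 →ₗᵢ[ℂ] L2 :=
  Lp.compMeasurePreservingₗᵢ ℂ (fun x => x + s) (measurePreserving_add_right volume s)

theorem shift_ae (s : ℝ) (f : L2) : shift s f =ᵐ[volume] fun x => f (x + s) :=
  Lp.coeFn_compMeasurePreserving f (measurePreserving_add_right volume s)

theorem ae_shift {p : ℝ → Prop} (h : ∀ᵐ x : ℝ, p x) (s : ℝ) : ∀ᵐ x : ℝ, p (x + s) :=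
  (measurePreserving_add_right volume s).quasiMeasurePreserving.ae h

theorem shift_shift (s t : ℝ) (f : L2) : shift s (shift t f) = shift (s + t) f := by
  apply Lp.ext
  filter_upwards [shift_ae s (shift t f), ae_shift (shift_ae t f) s, shift_ae (s + t) f]
    with x h1 h2 h3
  rw [h1, h2, h3, add_assoc]

theorem shift_zero (f : L2) : shift 0 f = f := by
  apply Lp.ext
  filter_upwards [shift_ae 0 f] with x h1
  rw [h1, add_zero]

theorem continuous_shift : Continuous fun p : ℝ × L2 => shift p.1 p.2 := by
  have hg : Continuous fun p : ℝ × L2 => (⟨fun x => x + p.1, by fun_prop⟩ : C(ℝ, ℝ)) := by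
    apply ContinuousMap.continuous_of_continuous_uncurry
    simp only [Function.uncurry_def, ContinuousMap.coe_mk]
    fun_prop
  exact continuous_snd.compMeasurePreservingLp hg
    (fun p => measurePreserving_add_right volume p.1) (by simp)

theorem memLp_coe {κ : ℝ → ℝ} (hκ : MemLp κ 2 (volume : Measure ℝ)) :
    MemLp (fun x => (κ x : ℂ)) 2 (volume : Measure ℝ) := hκ.ofReal

/-- Integration against a real square integrable weight. -/
def pairing (κ : ℝ → ℝ) (hκ : MemLp κ 2 (volume : Measure ℝ)) : L2 →L[ℂ] ℂ :=
  innerSL ℂ (MemLp.toLp (fun x => (κ x : ℂ)) (memLp_coe hκ))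

theorem pairing_apply (κ : ℝ → ℝ) (hκ : MemLp κ 2 (volume : Measure ℝ)) (f : L2) :
    pairing κ hκ f = ∫ x, κ x • f x := by
  rw [pairing, innerSL_apply_apply, L2.inner_def]
  apply integral_congr_ae
  filter_upwards [MemLp.coeFn_toLp (memLp_coe hκ)] with x hx
  rw [RCLike.inner_apply, hx]
  simp [mul_comm]

theorem integral_smul_shift (κ : ℝ → ℝ) (f : L2) (s : ℝ) :
    ∫ x, κ x • shift s f x = ∫ x, κ x • f (x + s) :=
  integral_congr_ae (by filter_upwards [shift_ae s f] with x hx; rw [hx])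

theorem integral_smul_shift' (κ : ℝ → ℝ) (f : L2) (s : ℝ) :
    ∫ x, κ x • shift s f x = ∫ x, κ (x - s) • f x := by
  rw [integral_smul_shift, ← integral_add_right_eq_self (fun x => κ (x - s) • f x) s]
  simp

theorem locallyIntegrable_L2 (f : L2) : LocallyIntegrable f (volume : Measure ℝ) :=
  (Lp.memLp f).locallyIntegrable (by norm_num)

/-- The pairing is the convolution of `x ↦ φ (-x)` with `f` evaluated at `s`, so the derivative
falls on the smooth factor and no regularity of `f` is needed. -/
theorem hasDerivAt_integral_smul_shift {φ : ℝ → ℝ} (hφ : ContDiff ℝ (⊤ : ℕ∞) φ)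
    (hc : HasCompactSupport φ) (f : L2) (s : ℝ) :
    HasDerivAt (fun s => ∫ x, φ x • shift s f x) (-∫ x, deriv φ x • shift s f x) s := by
  have hc' : HasCompactSupport (fun x => φ (-x)) := hc.comp_homeomorph (Homeomorph.neg ℝ)
  have hφ' : ContDiff ℝ 1 (fun x => φ (-x)) := (hφ.of_le (by simp)).comp contDiff_neg
  have h := HasCompactSupport.hasDerivAt_convolution_left (𝕜 := ℝ)
    (ContinuousLinearMap.lsmul ℝ ℝ : ℝ →L[ℝ] ℂ →L[ℝ] ℂ) (μ := volume) hc' hφ'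
    (locallyIntegrable_L2 f) s
  have key : ∀ (ψ : ℝ → ℝ) (r : ℝ), convolution (fun x => ψ (-x)) (f : ℝ → ℂ)
      (ContinuousLinearMap.lsmul ℝ ℝ : ℝ →L[ℝ] ℂ →L[ℝ] ℂ) volume r
      = ∫ x, ψ x • shift r f x := by
    intro ψ r
    rw [integral_smul_shift, convolution_def,
      ← integral_neg_eq_self (fun x => ψ x • f (x + r))]
    simp [sub_eq_neg_add]
  have hd : deriv (fun x => φ (-x)) = fun x => (fun y => - deriv φ y) (-x) := by
    ext x; simp [deriv_comp_neg]
  have e1 : convolution (fun x => φ (-x)) (f : ℝ → ℂ)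
      (ContinuousLinearMap.lsmul ℝ ℝ : ℝ →L[ℝ] ℂ →L[ℝ] ℂ) volume
      = fun r => ∫ x, φ x • shift r f x := funext (key φ)
  rw [hd, e1, key (fun y => - deriv φ y)] at h
  simpa [integral_neg, neg_smul] using h

theorem L2_ext_of_integral {f g : L2} (h : ∀ φ : ℝ → ℝ, ContDiff ℝ (⊤ : ℕ∞) φ →
    HasCompactSupport φ → ∫ x, φ x • f x = ∫ x, φ x • g x) : f = g := by
  apply Lp.ext
  exact ae_eq_of_integral_contDiff_smul_eq (locallyIntegrable_L2 f) (locallyIntegrable_L2 g) h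

theorem HasWeakDeriv.shift {f g : L2} (h : HasWeakDeriv f g) (s : ℝ) :
    HasWeakDeriv (shift s f) (shift s g) := by
  intro φ hφ hc
  have h1 : ContDiff ℝ (⊤ : ℕ∞) (fun x => φ (x - s)) := hφ.comp (contDiff_id.sub contDiff_const)
  have h2 : HasCompactSupport (fun x => φ (x - s)) := by
    simpa [sub_eq_add_neg, Function.comp_def] using hc.comp_homeomorph (Homeomorph.addRight (-s))
  have := h _ h1 h2
  rw [integral_smul_shift', integral_smul_shift', ← this]
  congr 1; ext x
  rw [deriv_comp_sub_const]

/-- Tested against any `φ`, the orbit of `f` has the orbit of `g` as its derivative. Hence `shift s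
f = f + ∫₀ˢ shift r g` in `L²`, and strong continuity of translations makes the right side
differentiable. With the converse below, the weak derivative is the generator of translations. -/
theorem HasWeakDeriv.hasDerivAt_shift_zero {f g : L2} (h : HasWeakDeriv f g) :
    HasDerivAt (fun s => NonlinearDirac.shift s f) g 0 := by
  have hcont : Continuous fun s => NonlinearDirac.shift s g :=
    continuous_shift.comp (continuous_id.prodMk continuous_const)
  have hrep : ∀ s, NonlinearDirac.shift s f = f + ∫ r in (0:ℝ)..s, NonlinearDirac.shift r g := by
    intro s
    rw [← sub_eq_iff_eq_add']
    apply L2_ext_of_integral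
    intro φ hφ hc
    have hm : MemLp φ 2 (volume : Measure ℝ) := hφ.continuous.memLp_of_hasCompactSupport hc
    rw [← pairing_apply φ hm, ← pairing_apply φ hm,
      ← ContinuousLinearMap.intervalIntegral_comp_comm _ (hcont.intervalIntegrable _ _), map_sub]
    symm
    have hd : ∀ x ∈ uIcc (0:ℝ) s, HasDerivAt (fun r => pairing φ hm (NonlinearDirac.shift r f))
        (pairing φ hm (NonlinearDirac.shift x g)) x := by
      intro x _
      simp only [pairing_apply]
      have := hasDerivAt_integral_smul_shift hφ hc f x
      rwa [(h.shift x) φ hφ hc, neg_neg] at this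
    rw [intervalIntegral.integral_eq_sub_of_hasDerivAt hd
      (((pairing φ hm).continuous.comp hcont).intervalIntegrable _ _), shift_zero]
  have := (intervalIntegral.integral_hasDerivAt_right (hcont.intervalIntegrable 0 0)
    (hcont.stronglyMeasurableAtFilter _ _) hcont.continuousAt).const_add f
  rw [shift_zero] at this
  exact this.congr_of_eventuallyEq (Filter.Eventually.of_forall hrep)

theorem hasWeakDeriv_of_hasDerivAt_shift_zero {f g : L2}
    (h : HasDerivAt (fun s => shift s f) g 0) : HasWeakDeriv f g := by
  intro φ hφ hc
  have hm : MemLp φ 2 (volume : Measure ℝ) := hφ.continuous.memLp_of_hasCompactSupport hc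
  have h1 := hasDerivAt_integral_smul_shift hφ hc f 0
  have h2 := (pairing φ hm).hasFDerivAt.restrictScalars ℝ |>.comp_hasDerivAt (0:ℝ) h
  have h3 : HasDerivAt (fun s => ∫ x, φ x • shift s f x) (pairing φ hm g) 0 := by
    refine h2.congr_of_eventuallyEq (Filter.Eventually.of_forall fun s => ?_)
    simp [pairing_apply]
  have := h1.unique h3
  rw [pairing_apply, shift_zero] at this
  rw [← this, neg_neg]

/-- Fubini on `ℝ × (-1, 0]`; it transfers the averaging formula for point values to pairings with
test functions. -/
theorem integral_smul_average {φ : ℝ → ℝ} (hφ : Continuous φ) (hc : HasCompactSupport φ)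
    {k : ℝ → ℝ} (hk : Continuous k) (f : L2) :
    ∫ x, φ x • ∫ s in (-1:ℝ)..0, k s • f (x + s) =
      ∫ s in (-1:ℝ)..0, k s • ∫ x, φ x • shift s f x := by
  have hm : MemLp φ 2 (volume : Measure ℝ) := hφ.memLp_of_hasCompactSupport hc
  have hfm : StronglyMeasurable f := Lp.stronglyMeasurable f
  obtain ⟨B, hB⟩ := (isCompact_Icc (a := (-1:ℝ)) (b := 0)).exists_bound_of_continuousOn
    hk.continuousOn
  have hInt : ∀ s, Integrable (fun x => φ x • f (x + s)) := fun s =>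
    (integrable_test_smul hφ hc (shift s f)).congr
      (by filter_upwards [shift_ae s f] with x hx; rw [hx])
  -- The elementary bound of a product by the sum of squares, with translation invariance, makes
  -- this uniform in `s`.
  have hbd : ∀ s, ∫ x, ‖φ x • f (x + s)‖ ≤ ((∫ x, φ x ^ 2) + ∫ x, ‖f x‖ ^ 2) := by
    intro s
    have h1 : Integrable fun x => φ x ^ 2 := hm.integrable_sq
    have h2 : Integrable fun x => ‖f x‖ ^ 2 := (Lp.memLp f).integrable_norm_pow (by simp)
    have h3 : Integrable fun x => ‖f (x + s)‖ ^ 2 := h2.comp_add_right s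
    rw [← integral_add_right_eq_self (fun x => ‖f x‖ ^ 2) s, ← integral_add h1 h3]
    refine integral_mono (hInt s).norm (h1.add h3) fun x => ?_
    simp only [norm_smul, Real.norm_eq_abs]
    nlinarith [sq_nonneg (|φ x| - ‖f (x + s)‖), sq_abs (φ x), sq_nonneg (φ x),
      sq_nonneg ‖f (x + s)‖]
  simp only [intervalIntegral.integral_of_le (show (-1:ℝ) ≤ 0 by norm_num), ← integral_smul]
  rw [integral_integral_swap]
  · apply integral_congr_ae
    refine Filter.Eventually.of_forall fun s => ?_
    simp only
    rw [integral_smul, integral_smul_shift, ← integral_smul]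
    congr 1; ext x
    rw [smul_comm]
  · have hsm : StronglyMeasurable (Function.uncurry fun x s => φ x • k s • f (x + s)) := by
      have h1 : StronglyMeasurable fun p : ℝ × ℝ => f (p.1 + p.2) :=
        hfm.comp_measurable (measurable_fst.add measurable_snd)
      exact (hφ.stronglyMeasurable.comp_measurable measurable_fst).smul
        ((hk.stronglyMeasurable.comp_measurable measurable_snd).smul h1)
    rw [integrable_prod_iff' hsm.aestronglyMeasurable]
    have hnorm : ∀ x s, ‖φ x • k s • f (x + s)‖ = ‖k s‖ * ‖φ x • f (x + s)‖ := by
      intro x s; rw [smul_comm, norm_smul]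
    refine ⟨Filter.Eventually.of_forall fun s => ?_, ?_⟩
    · simp only [Function.uncurry_apply_pair]
      exact ((hInt s).smul (k s)).congr (Filter.Eventually.of_forall fun x => by
        simp only [Pi.smul_apply]; rw [smul_comm])
    · refine Measure.integrableOn_of_bounded (M := B * (((∫ x, φ x ^ 2) + ∫ x, ‖f x‖ ^ 2)))
        (by simp) ?_ ?_
      · exact (hsm.norm.integral_prod_left' (μ := volume)).aestronglyMeasurable
      · filter_upwards [ae_restrict_mem measurableSet_Ioc] with s hs
        simp only [Function.uncurry_apply_pair, hnorm, integral_const_mul]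
        rw [norm_mul, norm_norm, Real.norm_of_nonneg (integral_nonneg fun _ => norm_nonneg _)]
        have := hB s (Ioc_subset_Icc_self hs)
        have h0 := hbd s
        have h1 : 0 ≤ ∫ x, ‖φ x • f (x + s)‖ := integral_nonneg fun _ => norm_nonneg _
        have := norm_nonneg (k s)
        have : 0 ≤ B := by linarith
        gcongr

/-! ### The Hilbert space H¹. -/

namespace H1

theorem hasWeakDeriv (f : H1) : HasWeakDeriv (toL2 f) (dx f) := f.2

/-- The element of `H¹(ℝ)` given by a function and its weak derivative. -/
def mk {f g : L2} (h : HasWeakDeriv f g) : H1 := ⟨WithLp.toLp 2 (f, g), h⟩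

@[simp] theorem toL2_mk {f g : L2} (h : HasWeakDeriv f g) : (toL2 (mk h)) = f := rfl
@[simp] theorem dx_mk {f g : L2} (h : HasWeakDeriv f g) : (dx (mk h)) = g := rfl

theorem ext' {f g : H1} (h1 : (toL2 f) = (toL2 g)) (h2 : (dx f) = (dx g)) : f = g := by
  apply Subtype.ext
  apply WithLp.ofLp_injective
  exact Prod.ext h1 h2

theorem toL2_add (f g : H1) : (toL2 (f + g)) = (toL2 f) + (toL2 g) := rfl
theorem dx_add (f g : H1) : (dx (f + g)) = (dx f) + (dx g) := rfl
theorem toL2_smul (c : ℂ) (f : H1) : (toL2 (c • f)) = c • (toL2 f) := rfl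
theorem dx_smul (c : ℂ) (f : H1) : (dx (c • f)) = c • (dx f) := rfl
theorem toL2_zero : (toL2 (0 : H1)) = 0 := rfl

theorem norm_sq (f : H1) : ‖f‖ ^ 2 = ‖(toL2 f)‖ ^ 2 + ‖(dx f)‖ ^ 2 :=
  WithLp.prod_norm_sq_eq_of_L2 (f : WithLp 2 (L2 × L2))

theorem norm_toL2_le (f : H1) : ‖(toL2 f)‖ ≤ ‖f‖ :=
  abs_le_of_sq_le_sq' (by rw [norm_sq]; nlinarith [sq_nonneg ‖(dx f)‖]) (norm_nonneg _) |>.2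

theorem norm_dx_le (f : H1) : ‖(dx f)‖ ≤ ‖f‖ :=
  abs_le_of_sq_le_sq' (by rw [norm_sq]; nlinarith [sq_nonneg ‖(toL2 f)‖]) (norm_nonneg _) |>.2

theorem norm_le (f : H1) : ‖f‖ ≤ ‖(toL2 f)‖ + ‖(dx f)‖ := by
  have h1 := norm_nonneg (toL2 f)
  have h2 := norm_nonneg (dx f)
  refine abs_le_of_sq_le_sq' ?_ (by positivity) |>.2
  rw [norm_sq]; nlinarith

/-- The inclusion of `H¹(ℝ)` in `L²(ℝ)`. -/
def toL2L : H1 →L[ℂ] L2 :=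
  LinearMap.mkContinuous ⟨⟨toL2, toL2_add⟩, toL2_smul⟩ 1
    (fun f => by simpa using norm_toL2_le f)

/-- The derivative as a bounded operator from `H¹(ℝ)` to `L²(ℝ)`. -/
def dxL : H1 →L[ℂ] L2 :=
  LinearMap.mkContinuous ⟨⟨dx, dx_add⟩, dx_smul⟩ 1
    (fun f => by simpa using norm_dx_le f)

@[simp] theorem toL2L_apply (f : H1) : toL2L f = (toL2 f) := rfl
@[simp] theorem dxL_apply (f : H1) : dxL f = (dx f) := rfl

theorem continuous_toL2 : Continuous toL2 := toL2L.continuous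
theorem continuous_dx : Continuous dx := dxL.continuous

/-- Being a weak derivative is a family of closed linear conditions, one per test function.
Completeness of `H1`, needed for the Picard–Lindelöf argument, follows. -/
theorem isClosed : IsClosed (H1 : Set (WithLp 2 (L2 × L2))) := by
  have : (H1 : Set (WithLp 2 (L2 × L2))) = ⋂ (φ : ℝ → ℝ), ⋂ (_ : ContDiff ℝ (⊤ : ℕ∞) φ),
      ⋂ (_ : HasCompactSupport φ),
      {p | ∫ x, deriv φ x • p.fst x = - ∫ x, φ x • p.snd x} := by
    ext p; simp only [mem_iInter]; rfl
  rw [this]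
  refine isClosed_iInter fun φ => isClosed_iInter fun hφ => isClosed_iInter fun hc => ?_
  have hd : Continuous (deriv φ) := hφ.continuous_deriv (by simp)
  have h1 : MemLp φ 2 (volume : Measure ℝ) := hφ.continuous.memLp_of_hasCompactSupport hc
  have h2 : MemLp (deriv φ) 2 (volume : Measure ℝ) := hd.memLp_of_hasCompactSupport hc.deriv
  simp only [← pairing_apply φ h1, ← pairing_apply _ h2]
  apply isClosed_eq
  · exact (pairing _ h2).continuous.comp (WithLp.prod_continuous_ofLp 2 L2 L2).fst
  · exact ((pairing _ h1).continuous.comp (WithLp.prod_continuous_ofLp 2 L2 L2).snd).neg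

instance : CompleteSpace H1 := isClosed.completeSpace_coe

/-- Translation on `H¹(ℝ)`. -/
def shiftFun (s : ℝ) (f : H1) : H1 := mk ((hasWeakDeriv f).shift s)

/-- Translation on `H¹(ℝ)` as a linear isometry. -/
def shift (s : ℝ) : H1 →ₗᵢ[ℂ] H1 where
  toFun := shiftFun s
  map_add' f g := ext' (map_add (NonlinearDirac.shift s) _ _)
    (map_add (NonlinearDirac.shift s) _ _)
  map_smul' c f := ext' (map_smul (NonlinearDirac.shift s) _ _)
    (map_smul (NonlinearDirac.shift s) _ _)
  norm_map' f := by
    have : ‖shiftFun s f‖ ^ 2 = ‖f‖ ^ 2 := by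
      rw [norm_sq, norm_sq]
      simp [shiftFun]
    simpa using this

@[simp] theorem toL2_shift (s : ℝ) (f : H1) :
    (toL2 (shift s f)) = NonlinearDirac.shift s (toL2 f) := rfl
@[simp] theorem dx_shift (s : ℝ) (f : H1) :
    (dx (shift s f)) = NonlinearDirac.shift s (dx f) := rfl

theorem shift_zero (f : H1) : shift 0 f = f :=
  ext' (NonlinearDirac.shift_zero _) (NonlinearDirac.shift_zero _)

theorem continuous_shift : Continuous fun p : ℝ × H1 => shift p.1 p.2 := by
  apply Continuous.subtype_mk
  refine (WithLp.prod_continuous_toLp 2 L2 L2).comp (Continuous.prodMk ?_ ?_)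
  · exact NonlinearDirac.continuous_shift.comp
      (continuous_fst.prodMk (continuous_toL2.comp continuous_snd))
  · exact NonlinearDirac.continuous_shift.comp
      (continuous_fst.prodMk (continuous_dx.comp continuous_snd))

theorem hasDerivAt_shift (f : H1) :
    HasDerivAt (fun s => NonlinearDirac.shift s (toL2 f)) (dx f) 0 :=
  (hasWeakDeriv f).hasDerivAt_shift_zero

end H1

/-! ### Continuous representatives and the Sobolev embedding. -/

/-- The weight `k` cut off to the interval `(-1, 0]`. -/
def cutWeight (k : ℝ → ℝ) : ℝ → ℝ := (Ioc (-1 : ℝ) 0).indicator k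

theorem memLp_cutWeight {k : ℝ → ℝ} (hk : Continuous k) :
    MemLp (cutWeight k) 2 (volume : Measure ℝ) := by
  rw [cutWeight, memLp_indicator_iff_restrict measurableSet_Ioc]
  have h : MemLp k 2 (volume.restrict (Icc (-1 : ℝ) 0)) := by
    obtain ⟨B, hB⟩ := (isCompact_Icc (a := (-1:ℝ)) (b := 0)).exists_bound_of_continuousOn
      hk.continuousOn
    exact MemLp.of_bound hk.aestronglyMeasurable B
      ((ae_restrict_mem measurableSet_Icc).mono hB)
  exact h.mono_measure (Measure.restrict_mono Ioc_subset_Icc_self le_rfl)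

theorem pairing_cutWeight_shift {k : ℝ → ℝ} (hk : Continuous k) (f : L2) (x : ℝ) :
    pairing (cutWeight k) (memLp_cutWeight hk) (shift x f) =
      ∫ s in (-1:ℝ)..0, k s • f (x + s) := by
  rw [pairing_apply, integral_smul_shift, intervalIntegral.integral_of_le (by norm_num),
    ← integral_indicator measurableSet_Ioc]
  congr 1; ext s
  by_cases hs : s ∈ Ioc (-1 : ℝ) 0 <;> simp [cutWeight, hs, add_comm]

namespace H1

theorem continuous_weight_one : Continuous fun _ : ℝ => (1 : ℝ) := continuous_const
theorem continuous_weight_lin : Continuous fun s : ℝ => 1 + s := by fun_prop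

/-- The value at `x` of the continuous representative of an `H¹` function. -/
def value (x : ℝ) : H1 →L[ℂ] ℂ :=
  -- The formula is `∫₋₁⁰ (f(x+s) + (1+s) f'(x+s)) ds`; the integrand is the `s`-derivative of
  -- `(1+s) f(x+s)`, which vanishes at `s = -1` and equals `f(x)` at `s = 0`.
  (pairing _ (memLp_cutWeight continuous_weight_one)).comp
      (((NonlinearDirac.shift x).toContinuousLinearMap).comp toL2L) +
    (pairing _ (memLp_cutWeight continuous_weight_lin)).comp
      (((NonlinearDirac.shift x).toContinuousLinearMap).comp dxL)

theorem value_apply (x : ℝ) (f : H1) : value x f =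
    pairing _ (memLp_cutWeight continuous_weight_one) (NonlinearDirac.shift x (toL2 f)) +
    pairing _ (memLp_cutWeight continuous_weight_lin) (NonlinearDirac.shift x (dx f)) := rfl

theorem continuous_value (f : H1) : Continuous fun x => value x f := by
  have h : ∀ g : L2, Continuous fun x => NonlinearDirac.shift x g := fun g =>
    NonlinearDirac.continuous_shift.comp (continuous_id.prodMk continuous_const)
  simp only [value_apply]
  exact ((pairing _ _).continuous.comp (h _)).add ((pairing _ _).continuous.comp (h _))

/-- The constant of the embedding of `H¹(ℝ)` in the bounded continuous functions. -/
def embConst : ℝ := ‖pairing _ (memLp_cutWeight continuous_weight_one)‖ +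
  ‖pairing _ (memLp_cutWeight continuous_weight_lin)‖

theorem embConst_nonneg : 0 ≤ embConst := by unfold embConst; positivity

theorem norm_value_le (x : ℝ) (f : H1) : ‖value x f‖ ≤ embConst * ‖f‖ := by
  rw [value_apply, embConst, add_mul]
  refine (norm_add_le _ _).trans (add_le_add ?_ ?_)
  · refine (ContinuousLinearMap.le_opNorm _ _).trans ?_
    rw [LinearIsometry.norm_map]
    gcongr
    exact norm_toL2_le f
  · refine (ContinuousLinearMap.le_opNorm _ _).trans ?_
    rw [LinearIsometry.norm_map]
    gcongr
    exact norm_dx_le f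

/-- The continuous representative of an `H¹` function. -/
def rep : H1 →L[ℂ] (ℝ →ᵇ ℂ) :=
  LinearMap.mkContinuous
    { toFun := fun f => BoundedContinuousFunction.ofNormedAddCommGroup (fun x => value x f)
        (continuous_value f) (embConst * ‖f‖) (fun x => norm_value_le x f)
      map_add' := fun f g => by ext x; simp
      map_smul' := fun c f => by ext x; simp } embConst
    (fun f => BoundedContinuousFunction.norm_ofNormedAddCommGroup_le _
      (mul_nonneg embConst_nonneg (norm_nonneg _)) (fun x => norm_value_le x f))

@[simp] theorem rep_apply (f : H1) (x : ℝ) : rep f x = value x f := rfl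

theorem norm_rep_le (f : H1) : ‖rep f‖ ≤ embConst * ‖f‖ :=
  (BoundedContinuousFunction.norm_le (mul_nonneg embConst_nonneg (norm_nonneg _))).2
    fun x => norm_value_le x f

/-- The fundamental theorem of calculus for `(1+s) f(x+s)` on `[-1, 0]` is carried out after pairing
with a test function in `x`, where the orbit of `f` is differentiable in `s`. -/
theorem value_ae_eq (f : H1) : (fun x => value x f) =ᵐ[volume] (toL2 f) := by
  apply ae_eq_of_integral_contDiff_smul_eq (continuous_value f).locallyIntegrable
    (locallyIntegrable_L2 _)
  intro φ hφ hc
  have hd : ∀ x ∈ uIcc (-1:ℝ) 0, HasDerivAt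
      (fun s => (1 + s) • ∫ x, φ x • NonlinearDirac.shift s (toL2 f) x)
      ((1 + x) • (∫ y, φ y • NonlinearDirac.shift x (dx f) y) +
        (1:ℝ) • ∫ y, φ y • NonlinearDirac.shift x (toL2 f) y) x := by
    intro x _
    have h1 := hasDerivAt_integral_smul_shift hφ hc (toL2 f) x
    rw [((hasWeakDeriv f).shift x) φ hφ hc, neg_neg] at h1
    exact ((hasDerivAt_id x).const_add 1).smul h1
  have hm : MemLp φ 2 (volume : Measure ℝ) := hφ.continuous.memLp_of_hasCompactSupport hc
  have hcont : ∀ g : L2, Continuous fun s => ∫ y, φ y • NonlinearDirac.shift s g y := by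
    intro g
    simp only [← pairing_apply φ hm]
    exact (pairing φ hm).continuous.comp
      (NonlinearDirac.continuous_shift.comp (continuous_id.prodMk continuous_const))
  have hi1 : Continuous fun s : ℝ => (1 + s) • ∫ y, φ y • NonlinearDirac.shift s (dx f) y :=
    continuous_weight_lin.smul (hcont _)
  have hi2 : Continuous fun s : ℝ => (1:ℝ) • ∫ y, φ y • NonlinearDirac.shift s (toL2 f) y :=
    continuous_weight_one.smul (hcont _)
  have hint : ∀ {k : ℝ → ℝ} (hk : Continuous k) (g : L2), Integrable fun x =>
      φ x • pairing _ (memLp_cutWeight hk) (NonlinearDirac.shift x g) := by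
    intro k hk g
    refine Continuous.integrable_of_hasCompactSupport ?_ hc.smul_right
    exact hφ.continuous.smul ((pairing _ _).continuous.comp
      (NonlinearDirac.continuous_shift.comp (continuous_id.prodMk continuous_const)))
  have key := intervalIntegral.integral_eq_sub_of_hasDerivAt hd
    ((hi1.add hi2).intervalIntegrable _ _)
  rw [intervalIntegral.integral_add (hi1.intervalIntegrable _ _) (hi2.intervalIntegrable _ _),
    ← integral_smul_average hφ.continuous hc continuous_weight_lin,
    ← integral_smul_average hφ.continuous hc continuous_weight_one] at key
  simp only [← pairing_cutWeight_shift continuous_weight_lin,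
    ← pairing_cutWeight_shift continuous_weight_one] at key
  rw [← integral_add (hint _ _) (hint _ _)] at key
  simp only [NonlinearDirac.shift_zero] at key
  simp only [value_apply, smul_add]
  · simpa [add_comm] using key
  · exact continuous_weight_lin
  · exact continuous_weight_one

theorem value_shift (s x : ℝ) (f : H1) : value x (shift s f) = value (x + s) f := by
  simp only [value_apply, toL2_shift, dx_shift, NonlinearDirac.shift_shift]

end H1

/-! ### Products and conjugation in H¹. -/

theorem memLp_bmul (F : ℝ →ᵇ ℂ) (g : L2) :
    MemLp (fun x => F x * g x) 2 (volume : Measure ℝ) := by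
  refine (Lp.memLp g).of_le_mul (c := ‖F‖)
    (F.continuous.aestronglyMeasurable.mul (Lp.aestronglyMeasurable g)) ?_
  refine Filter.Eventually.of_forall fun x => ?_
  rw [norm_mul]
  gcongr
  exact F.norm_coe_le_norm x

/-- Product of a bounded continuous function and a square integrable function. -/
def bmulFun (F : ℝ →ᵇ ℂ) (g : L2) : L2 := (memLp_bmul F g).toLp _

theorem bmulFun_ae (F : ℝ →ᵇ ℂ) (g : L2) : bmulFun F g =ᵐ[volume] fun x => F x * g x :=
  MemLp.coeFn_toLp _

/-- Product of a bounded continuous function and a square integrable function, as a bounded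
bilinear map. -/
def bmul : (ℝ →ᵇ ℂ) →L[ℂ] L2 →L[ℂ] L2 :=
  LinearMap.mkContinuous₂ (LinearMap.mk₂ ℂ bmulFun
    (fun F F' g => by
      apply Lp.ext
      filter_upwards [bmulFun_ae (F + F') g, bmulFun_ae F g, bmulFun_ae F' g,
        Lp.coeFn_add (bmulFun F g) (bmulFun F' g)] with x h1 h2 h3 h4
      rw [h1, h4, Pi.add_apply, h2, h3, BoundedContinuousFunction.add_apply, add_mul])
    (fun c F g => by
      apply Lp.ext
      filter_upwards [bmulFun_ae (c • F) g, bmulFun_ae F g,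
        Lp.coeFn_smul c (bmulFun F g)] with x h1 h2 h4
      rw [h1, h4, Pi.smul_apply, h2, BoundedContinuousFunction.smul_apply, smul_mul_assoc])
    (fun F g g' => by
      apply Lp.ext
      filter_upwards [bmulFun_ae F (g + g'), bmulFun_ae F g, bmulFun_ae F g',
        Lp.coeFn_add (bmulFun F g) (bmulFun F g'), Lp.coeFn_add g g'] with x h1 h2 h3 h4 h5
      rw [h1, h4, Pi.add_apply, h2, h3, h5, Pi.add_apply, mul_add])
    (fun c F g => by
      apply Lp.ext
      filter_upwards [bmulFun_ae F (c • g), bmulFun_ae F g,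
        Lp.coeFn_smul c (bmulFun F g), Lp.coeFn_smul c g] with x h1 h2 h4 h5
      rw [h1, h4, Pi.smul_apply, h2, h5, Pi.smul_apply, mul_smul_comm])) 1
    (fun F g => by
      rw [one_mul]
      refine Lp.norm_le_mul_norm_of_ae_le_mul ?_
      filter_upwards [bmulFun_ae F g] with x hx
      simp only [LinearMap.mk₂_apply]
      rw [hx, norm_mul]
      gcongr
      exact F.norm_coe_le_norm x)

theorem bmul_ae (F : ℝ →ᵇ ℂ) (g : L2) : bmul F g =ᵐ[volume] fun x => F x * g x :=
  bmulFun_ae F g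

theorem norm_bmul_le (F : ℝ →ᵇ ℂ) (g : L2) : ‖bmul F g‖ ≤ ‖F‖ * ‖g‖ := by
  refine Lp.norm_le_mul_norm_of_ae_le_mul ?_
  filter_upwards [bmul_ae F g] with x hx
  rw [hx, norm_mul]
  gcongr
  exact F.norm_coe_le_norm x

theorem tendsto_clm_apply₂ {α E F G : Type*} [NormedAddCommGroup E] [NormedSpace ℂ E]
    [NormedAddCommGroup F] [NormedSpace ℂ F] [NormedAddCommGroup G] [NormedSpace ℂ G]
    (B : E →L[ℂ] F →L[ℂ] G) {l : Filter α} {f : α → E} {f₀ : E} {g : α → F} {g₀ : F}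
    (hf : Filter.Tendsto f l (𝓝 f₀)) (hg : Filter.Tendsto g l (𝓝 g₀)) :
    Filter.Tendsto (fun s => B (f s) (g s)) l (𝓝 (B f₀ g₀)) := by
  have h : Continuous fun p : E × F => B p.1 p.2 := B.continuous₂
  exact (h.tendsto (f₀, g₀)).comp (hf.prodMk_nhds hg)

theorem tendsto_bmul {α : Type*} {l : Filter α} {F : α → ℝ →ᵇ ℂ} {F₀ : ℝ →ᵇ ℂ} {g : α → L2}
    {g₀ : L2} (hF : Filter.Tendsto F l (𝓝 F₀)) (hg : Filter.Tendsto g l (𝓝 g₀)) :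
    Filter.Tendsto (fun s => bmul (F s) (g s)) l (𝓝 (bmul F₀ g₀)) :=
  tendsto_clm_apply₂ bmul hF hg

theorem norm_star_L2 (f : L2) : ‖(star f : L2)‖ = ‖f‖ := by
  apply le_antisymm <;> apply Lp.norm_le_norm_of_ae_le
  all_goals filter_upwards [Lp.coeFn_star f] with x hx; rw [hx]; simp

theorem hasWeakDeriv_star {f g : L2} (h : HasWeakDeriv f g) : HasWeakDeriv (star f) (star g) := by
  intro φ hφ hc
  have := congrArg (starRingEnd ℂ) (h φ hφ hc)
  rw [map_neg, ← integral_conj, ← integral_conj] at this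
  rw [integral_congr_ae (g := fun x => (starRingEnd ℂ) (deriv φ x • f x)), this,
    integral_congr_ae (f := fun x => φ x • (star g : L2) x)
      (g := fun x => (starRingEnd ℂ) (φ x • g x))]
  · filter_upwards [Lp.coeFn_star g] with x hx
    rw [hx]; simp
  · filter_upwards [Lp.coeFn_star f] with x hx
    rw [hx]; simp

namespace H1

theorem value_eq_of_ae {f : H1} {h : ℝ → ℂ} (hc : Continuous h) (hae : h =ᵐ[volume] toL2 f)
    (x : ℝ) : value x f = h x :=
  congrFun ((Continuous.ae_eq_iff_eq volume (continuous_value f) hc).1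
    ((value_ae_eq f).trans hae.symm)) x

theorem toL2_injective : Function.Injective toL2 := by
  intro f g h
  refine ext' h ?_
  have h1 := hasDerivAt_shift f
  rw [h] at h1
  exact h1.unique (hasDerivAt_shift g)

theorem ext_value {f g : H1} (h : ∀ x, value x f = value x g) : f = g := by
  apply toL2_injective
  apply Lp.ext
  filter_upwards [value_ae_eq f, value_ae_eq g] with x h1 h2
  rw [← h1, ← h2, h]

theorem bmul_rep_comm (f g : H1) : bmul (rep f) (toL2 g) = bmul (rep g) (toL2 f) := by
  apply Lp.ext
  filter_upwards [bmul_ae (rep f) (toL2 g), bmul_ae (rep g) (toL2 f), value_ae_eq f,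
    value_ae_eq g] with x h1 h2 h3 h4
  rw [h1, h2, ← h3, ← h4, rep_apply, rep_apply, mul_comm]

theorem shift_bmul_rep (s : ℝ) (f : H1) (g : L2) :
    NonlinearDirac.shift s (bmul (rep f) g) =
      bmul (rep (shift s f)) (NonlinearDirac.shift s g) := by
  apply Lp.ext
  filter_upwards [shift_ae s (bmul (rep f) g), ae_shift (bmul_ae (rep f) g) s,
    bmul_ae (rep (shift s f)) (NonlinearDirac.shift s g), shift_ae s g] with x h1 h2 h3 h4
  rw [h1, h2, h3, h4, rep_apply, rep_apply, value_shift]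

/-- The Leibniz rule is read off the difference quotients of translates, using that the weak
derivative generates translations; the factor `rep (shift s f)` converges uniformly because `H¹`
embeds in the bounded functions. -/
theorem hasWeakDeriv_bmul (f g : H1) : HasWeakDeriv (bmul (rep f) (toL2 g))
    (bmul (rep f) (dx g) + bmul (rep g) (dx f)) := by
  apply hasWeakDeriv_of_hasDerivAt_shift_zero
  rw [hasDerivAt_iff_tendsto_slope]
  have hf := hasDerivAt_iff_tendsto_slope.1 (hasDerivAt_shift f)
  have hg := hasDerivAt_iff_tendsto_slope.1 (hasDerivAt_shift g)
  have hcont : Filter.Tendsto (fun s => rep (shift s f)) (𝓝[≠] 0) (𝓝 (rep f)) := by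
    have : Continuous fun s => rep (shift s f) := rep.continuous.comp
      (continuous_shift.comp (continuous_id.prodMk continuous_const))
    have h := this.tendsto 0
    rw [shift_zero] at h
    exact h.mono_left nhdsWithin_le_nhds
  have hlim : Filter.Tendsto (fun s => bmul (rep (shift s f))
        (slope (fun s => NonlinearDirac.shift s (toL2 g)) 0 s) +
      bmul (rep g) (slope (fun s => NonlinearDirac.shift s (toL2 f)) 0 s)) (𝓝[≠] 0)
      (𝓝 (bmul (rep f) (dx g) + bmul (rep g) (dx f))) := by
    refine Filter.Tendsto.add ?_ (tendsto_bmul tendsto_const_nhds hf)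
    exact tendsto_bmul hcont hg
  refine hlim.congr fun s => ?_
  simp only [slope_def_module, sub_zero, NonlinearDirac.shift_zero]
  rw [ContinuousLinearMap.map_smul_of_tower, ContinuousLinearMap.map_smul_of_tower, ← smul_add,
    shift_bmul_rep, map_sub, map_sub]
  congr 1
  -- The splitting is `f_s g_s - f g = f_s (g_s - g) + g (f_s - f)`; commutativity cancels the cross
  -- terms `f_s g` and `g f_s`.
  have h1 := bmul_rep_comm (shift s f) g
  rw [toL2_shift] at h1
  rw [← h1, ← bmul_rep_comm f g]
  abel

/-- The product of two `H¹` functions. -/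
def mul (f g : H1) : H1 := mk (hasWeakDeriv_bmul f g)

theorem value_mul (x : ℝ) (f g : H1) : value x (mul f g) = value x f * value x g := by
  refine value_eq_of_ae (h := fun x => value x f * value x g)
    ((continuous_value f).mul (continuous_value g)) ?_ x
  filter_upwards [bmul_ae (rep f) (toL2 g), value_ae_eq g] with x h1 h2
  rw [mul, toL2_mk, h1, rep_apply, h2]

/-- The tame form, with one factor always in sup norm, keeps the estimate linear in the `H¹` norm.
This linearity is what lets Gronwall give a bound for all times. -/
theorem norm_mul_le (f g : H1) : ‖mul f g‖ ≤ 2 * (‖rep f‖ * ‖g‖ + ‖rep g‖ * ‖f‖) := by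
  refine (norm_le _).trans ?_
  rw [mul, toL2_mk, dx_mk]
  have h1 := (norm_bmul_le (rep f) (toL2 g)).trans
    (mul_le_mul_of_nonneg_left (norm_toL2_le g) (norm_nonneg _))
  have h2 := (norm_bmul_le (rep f) (dx g)).trans
    (mul_le_mul_of_nonneg_left (norm_dx_le g) (norm_nonneg _))
  have h3 := (norm_bmul_le (rep g) (dx f)).trans
    (mul_le_mul_of_nonneg_left (norm_dx_le f) (norm_nonneg _))
  have h4 := norm_add_le (bmul (rep f) (dx g)) (bmul (rep g) (dx f))
  have h5 : 0 ≤ ‖rep g‖ * ‖f‖ := by positivity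
  linarith

theorem mul_sub_mul (f f' g g' : H1) :
    mul f g - mul f' g' = mul (f - f') g + mul f' (g - g') := by
  apply ext_value
  intro x
  simp only [map_sub, map_add, value_mul]
  ring

theorem norm_toL2_mul_le (f g : H1) : ‖toL2 (mul f g)‖ ≤ ‖rep f‖ * ‖toL2 g‖ :=
  norm_bmul_le _ _

theorem norm_toL2_mul_le' (f g : H1) : ‖toL2 (mul f g)‖ ≤ ‖rep g‖ * ‖toL2 f‖ := by
  rw [mul, toL2_mk, bmul_rep_comm]
  exact norm_bmul_le _ _

/-- The complex conjugate of an `H¹` function. -/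
def conj (f : H1) : H1 := mk (hasWeakDeriv_star (hasWeakDeriv f))

theorem value_conj (x : ℝ) (f : H1) : value x (conj f) = star (value x f) := by
  refine value_eq_of_ae (h := fun x => star (value x f)) (continuous_value f).star ?_ x
  filter_upwards [Lp.coeFn_star (toL2 f), value_ae_eq f] with x h1 h2
  rw [conj, toL2_mk, h1, Pi.star_apply, h2]

theorem conj_sub (f g : H1) : conj f - conj g = conj (f - g) := by
  apply ext_value; intro x; simp [value_conj]

theorem norm_toL2_conj (f : H1) : ‖toL2 (conj f)‖ = ‖toL2 f‖ := by
  rw [conj, toL2_mk, norm_star_L2]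

theorem norm_conj (f : H1) : ‖conj f‖ = ‖f‖ := by
  have : ‖conj f‖ ^ 2 = ‖f‖ ^ 2 := by
    rw [norm_sq, norm_sq, norm_toL2_conj]
    have : ‖dx (conj f)‖ = ‖dx f‖ := by rw [conj, dx_mk, norm_star_L2]
    rw [this]
  simpa using this

theorem norm_rep_conj (f : H1) : ‖rep (conj f)‖ ≤ ‖rep f‖ :=
  (BoundedContinuousFunction.norm_le (norm_nonneg _)).2 fun x => by
    rw [rep_apply, value_conj, norm_star]
    exact (rep f).norm_coe_le_norm x

end H1

open H1

/-! ### Polynomial nonlinearities acting on H¹. -/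

/-- `N` is the superposition operator on `H¹ × H¹` of the nonlinearity `G`, with the local
Lipschitz and tame estimates needed for the Cauchy problem. -/
structure IsLift (G : ℂ → ℂ → ℂ) (N : H1 × H1 → H1) : Prop where
  value_eq : ∀ w x, value x (N w) = G (value x w.1) (value x w.2)
  lipschitz : ∀ ρ : ℝ, ∃ K, 0 ≤ K ∧ ∀ w w', ‖w‖ ≤ ρ → ‖w'‖ ≤ ρ → ‖N w - N w'‖ ≤ K * ‖w - w'‖
  lipschitz_L2 : ∀ ρ : ℝ, ∃ K, 0 ≤ K ∧ ∀ w w', ‖w‖ ≤ ρ → ‖w'‖ ≤ ρ →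
    ‖toL2 (N w - N w')‖ ≤ K * max ‖toL2 (w.1 - w'.1)‖ ‖toL2 (w.2 - w'.2)‖
  sup_bound : ∀ R : ℝ, ∃ M, 0 ≤ M ∧ ∀ w, ‖rep w.1‖ ≤ R → ‖rep w.2‖ ≤ R → ‖rep (N w)‖ ≤ M
  tame : ∀ R : ℝ, ∃ C, 0 ≤ C ∧ ∀ w, ‖rep w.1‖ ≤ R → ‖rep w.2‖ ≤ R → ‖N w‖ ≤ C * ‖w‖

namespace IsLift

theorem fst : IsLift (fun u _ => u) Prod.fst where
  value_eq _ _ := rfl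
  lipschitz _ := ⟨1, zero_le_one, fun w w' _ _ => by simpa using norm_fst_le (w - w')⟩
  lipschitz_L2 _ := ⟨1, zero_le_one, fun w w' _ _ => by simp⟩
  sup_bound R := ⟨max R 0, le_max_right _ _, fun w h _ => h.trans (le_max_left _ _)⟩
  tame _ := ⟨1, zero_le_one, fun w _ _ => by simpa using norm_fst_le w⟩

theorem snd : IsLift (fun _ v => v) Prod.snd where
  value_eq _ _ := rfl
  lipschitz _ := ⟨1, zero_le_one, fun w w' _ _ => by simpa using norm_snd_le (w - w')⟩
  lipschitz_L2 _ := ⟨1, zero_le_one, fun w w' _ _ => by simp⟩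
  sup_bound R := ⟨max R 0, le_max_right _ _, fun w _ h => h.trans (le_max_left _ _)⟩
  tame _ := ⟨1, zero_le_one, fun w _ _ => by simpa using norm_snd_le w⟩

theorem zero : IsLift (fun _ _ => 0) (fun _ => 0) where
  value_eq _ _ := by simp
  lipschitz _ := ⟨0, le_rfl, fun w w' _ _ => by simp⟩
  lipschitz_L2 _ := ⟨0, le_rfl, fun w w' _ _ => by simp [toL2_zero]⟩
  sup_bound R := ⟨0, le_rfl, fun w _ h => by simp⟩
  tame _ := ⟨0, le_rfl, fun w _ _ => by simp⟩

variable {G G' : ℂ → ℂ → ℂ} {N N' : H1 × H1 → H1}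

theorem conj (h : IsLift G N) : IsLift (fun u v => star (G u v)) (fun w => H1.conj (N w)) where
  value_eq w x := by rw [value_conj, h.value_eq]
  lipschitz ρ := by
    obtain ⟨K, hK, H⟩ := h.lipschitz ρ
    exact ⟨K, hK, fun w w' h1 h2 => by rw [conj_sub, norm_conj]; exact H w w' h1 h2⟩
  lipschitz_L2 ρ := by
    obtain ⟨K, hK, H⟩ := h.lipschitz_L2 ρ
    exact ⟨K, hK, fun w w' h1 h2 => by rw [conj_sub, norm_toL2_conj]; exact H w w' h1 h2⟩
  sup_bound R := by
    obtain ⟨M, hM, H⟩ := h.sup_bound R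
    exact ⟨M, hM, fun w h1 h2 => (norm_rep_conj _).trans (H w h1 h2)⟩
  tame R := by
    obtain ⟨M, hM, H⟩ := h.tame R
    exact ⟨M, hM, fun w h1 h2 => by rw [norm_conj]; exact H w h1 h2⟩

theorem smul (h : IsLift G N) (c : ℂ) : IsLift (fun u v => c * G u v) (fun w => c • N w) where
  value_eq w x := by simp [h.value_eq]
  lipschitz ρ := by
    obtain ⟨K, hK, H⟩ := h.lipschitz ρ
    refine ⟨‖c‖ * K, by positivity, fun w w' h1 h2 => ?_⟩
    rw [← smul_sub, norm_smul, mul_assoc]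
    exact mul_le_mul_of_nonneg_left (H w w' h1 h2) (norm_nonneg _)
  lipschitz_L2 ρ := by
    obtain ⟨K, hK, H⟩ := h.lipschitz_L2 ρ
    refine ⟨‖c‖ * K, by positivity, fun w w' h1 h2 => ?_⟩
    rw [← smul_sub, toL2_smul, norm_smul, mul_assoc]
    exact mul_le_mul_of_nonneg_left (H w w' h1 h2) (norm_nonneg _)
  sup_bound R := by
    obtain ⟨M, hM, H⟩ := h.sup_bound R
    refine ⟨‖c‖ * M, by positivity, fun w h1 h2 => ?_⟩
    rw [map_smul, norm_smul]
    exact mul_le_mul_of_nonneg_left (H w h1 h2) (norm_nonneg _)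
  tame R := by
    obtain ⟨M, hM, H⟩ := h.tame R
    refine ⟨‖c‖ * M, by positivity, fun w h1 h2 => ?_⟩
    rw [norm_smul, mul_assoc]
    exact mul_le_mul_of_nonneg_left (H w h1 h2) (norm_nonneg _)

theorem add (h : IsLift G N) (h' : IsLift G' N') :
    IsLift (fun u v => G u v + G' u v) (fun w => N w + N' w) where
  value_eq w x := by simp [h.value_eq, h'.value_eq]
  lipschitz ρ := by
    obtain ⟨K, hK, H⟩ := h.lipschitz ρ
    obtain ⟨K', hK', H'⟩ := h'.lipschitz ρ
    refine ⟨K + K', by positivity, fun w w' h1 h2 => ?_⟩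
    rw [add_sub_add_comm, add_mul]
    exact (norm_add_le _ _).trans (add_le_add (H w w' h1 h2) (H' w w' h1 h2))
  lipschitz_L2 ρ := by
    obtain ⟨K, hK, H⟩ := h.lipschitz_L2 ρ
    obtain ⟨K', hK', H'⟩ := h'.lipschitz_L2 ρ
    refine ⟨K + K', by positivity, fun w w' h1 h2 => ?_⟩
    rw [add_sub_add_comm, add_mul, toL2_add]
    exact (norm_add_le _ _).trans (add_le_add (H w w' h1 h2) (H' w w' h1 h2))
  sup_bound R := by
    obtain ⟨M, hM, H⟩ := h.sup_bound R
    obtain ⟨M', hM', H'⟩ := h'.sup_bound R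
    refine ⟨M + M', by positivity, fun w h1 h2 => ?_⟩
    rw [map_add]
    exact (norm_add_le _ _).trans (add_le_add (H w h1 h2) (H' w h1 h2))
  tame R := by
    obtain ⟨M, hM, H⟩ := h.tame R
    obtain ⟨M', hM', H'⟩ := h'.tame R
    refine ⟨M + M', by positivity, fun w h1 h2 => ?_⟩
    rw [add_mul]
    exact (norm_add_le _ _).trans (add_le_add (H w h1 h2) (H' w h1 h2))

theorem norm_rep_le_of_norm_le {w : H1 × H1} {ρ : ℝ} (hw : ‖w‖ ≤ ρ) :
    ‖rep w.1‖ ≤ embConst * ρ ∧ ‖rep w.2‖ ≤ embConst * ρ :=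
  ⟨(norm_rep_le _).trans (mul_le_mul_of_nonneg_left ((norm_fst_le w).trans hw) embConst_nonneg),
    (norm_rep_le _).trans (mul_le_mul_of_nonneg_left ((norm_snd_le w).trans hw) embConst_nonneg)⟩

theorem bounded (h : IsLift G N) (ρ : ℝ) : ∃ B, 0 ≤ B ∧ ∀ w, ‖w‖ ≤ ρ → ‖N w‖ ≤ B := by
  obtain ⟨C, hC, H⟩ := h.tame (embConst * ρ)
  refine ⟨C * |ρ|, by positivity, fun w hw => ?_⟩
  obtain ⟨h1, h2⟩ := norm_rep_le_of_norm_le hw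
  exact (H w h1 h2).trans (mul_le_mul_of_nonneg_left (hw.trans (le_abs_self _)) hC)

theorem mul (h : IsLift G N) (h' : IsLift G' N') :
    IsLift (fun u v => G u v * G' u v) (fun w => H1.mul (N w) (N' w)) where
  value_eq w x := by rw [value_mul, h.value_eq, h'.value_eq]
  lipschitz ρ := by
    obtain ⟨K, hK, H⟩ := h.lipschitz ρ
    obtain ⟨K', hK', H'⟩ := h'.lipschitz ρ
    obtain ⟨B, hB, HB⟩ := h.bounded ρ
    obtain ⟨B', hB', HB'⟩ := h'.bounded ρ
    have := embConst_nonneg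
    refine ⟨4 * embConst * (K * B' + B * K'), by positivity, fun w w' h1 h2 => ?_⟩
    have key : ∀ f g : H1, ‖H1.mul f g‖ ≤ 4 * embConst * (‖f‖ * ‖g‖) := fun f g => by
      have h1 := norm_mul_le f g
      have h2 := mul_le_mul_of_nonneg_right (norm_rep_le f) (norm_nonneg g)
      have h3 := mul_le_mul_of_nonneg_right (norm_rep_le g) (norm_nonneg f)
      linarith
    rw [mul_sub_mul]
    calc _ ≤ 4 * embConst * (‖N w - N w'‖ * ‖N' w‖) + 4 * embConst * (‖N w'‖ * ‖N' w - N' w'‖) :=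
          (norm_add_le _ _).trans (add_le_add (key _ _) (key _ _))
      _ ≤ 4 * embConst * ((K * ‖w - w'‖) * B') + 4 * embConst * (B * (K' * ‖w - w'‖)) := by
          gcongr
          · exact H w w' h1 h2
          · exact HB' w h1
          · exact HB w' h2
          · exact H' w w' h1 h2
      _ = _ := by ring
  lipschitz_L2 ρ := by
    obtain ⟨K, hK, H⟩ := h.lipschitz_L2 ρ
    obtain ⟨K', hK', H'⟩ := h'.lipschitz_L2 ρ
    obtain ⟨B, hB, HB⟩ := h.sup_bound (embConst * ρ)
    obtain ⟨B', hB', HB'⟩ := h'.sup_bound (embConst * ρ)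
    refine ⟨B' * K + B * K', by positivity, fun w w' h1 h2 => ?_⟩
    obtain ⟨h3, h4⟩ := norm_rep_le_of_norm_le h1
    obtain ⟨h5, h6⟩ := norm_rep_le_of_norm_le h2
    rw [mul_sub_mul, toL2_add]
    set m := max ‖toL2 (w.1 - w'.1)‖ ‖toL2 (w.2 - w'.2)‖
    calc _ ≤ ‖rep (N' w)‖ * ‖toL2 (N w - N w')‖ + ‖rep (N w')‖ * ‖toL2 (N' w - N' w')‖ :=
          (norm_add_le _ _).trans (add_le_add (norm_toL2_mul_le' _ _) (norm_toL2_mul_le _ _))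
      _ ≤ B' * (K * m) + B * (K' * m) := by
          gcongr
          · exact HB' w h3 h4
          · exact H w w' h1 h2
          · exact HB w' h5 h6
          · exact H' w w' h1 h2
      _ = _ := by ring
  sup_bound R := by
    obtain ⟨M, hM, H⟩ := h.sup_bound R
    obtain ⟨M', hM', H'⟩ := h'.sup_bound R
    refine ⟨M * M', by positivity, fun w h1 h2 => ?_⟩
    refine (BoundedContinuousFunction.norm_le (by positivity)).2 fun x => ?_
    rw [rep_apply, value_mul, norm_mul]
    gcongr
    · exact ((rep (N w)).norm_coe_le_norm x).trans (H w h1 h2)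
    · exact ((rep (N' w)).norm_coe_le_norm x).trans (H' w h1 h2)
  tame R := by
    obtain ⟨M, hM, H⟩ := h.sup_bound R
    obtain ⟨M', hM', H'⟩ := h'.sup_bound R
    obtain ⟨C, hC, HC⟩ := h.tame R
    obtain ⟨C', hC', HC'⟩ := h'.tame R
    refine ⟨2 * (M * C' + M' * C), by positivity, fun w h1 h2 => ?_⟩
    calc _ ≤ 2 * (‖rep (N w)‖ * ‖N' w‖ + ‖rep (N' w)‖ * ‖N w‖) := norm_mul_le _ _
      _ ≤ 2 * (M * (C' * ‖w‖) + M' * (C * ‖w‖)) := by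
          gcongr
          · exact H w h1 h2
          · exact HC' w h1 h2
          · exact H' w h1 h2
          · exact HC w h1 h2
      _ = _ := by ring

theorem map_zero (h : IsLift G N) : N 0 = 0 := by
  obtain ⟨C, _, H⟩ := h.tame 0
  have := H 0 (by simp) (by simp)
  simpa using this

theorem apply_zero (h : IsLift G N) : G 0 0 = 0 := by
  have := h.value_eq 0 0
  simpa [h.map_zero] using this.symm

end IsLift

/-- Nonzero constants are not in `H¹`, so the induction on polynomials must carry a constant that is
subtracted. -/
theorem exists_isLift_sub_const (P : MvPolynomial (Fin 4) ℂ) : ∃ (k : ℂ) (N : H1 × H1 → H1),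
    IsLift (fun u v => MvPolynomial.eval ![u, v, star u, star v] P - k) N := by
  induction P using MvPolynomial.induction_on with
  | C a => exact ⟨a, _, by simpa using IsLift.zero⟩
  | add p q hp hq =>
    obtain ⟨k, N, h⟩ := hp
    obtain ⟨k', N', h'⟩ := hq
    refine ⟨k + k', fun w => N w + N' w, ?_⟩
    convert h.add h' using 3
    simp only [map_add]; ring
  | mul_X p i hp =>
    obtain ⟨k, N, h⟩ := hp
    obtain ⟨N', h'⟩ : ∃ N', IsLift (fun u v => (![u, v, star u, star v] : Fin 4 → ℂ) i) N' := by
      fin_cases i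
      · exact ⟨_, IsLift.fst⟩
      · exact ⟨_, IsLift.snd⟩
      · exact ⟨_, IsLift.fst.conj⟩
      · exact ⟨_, IsLift.snd.conj⟩
    -- Here `p X = (p - k) X + k X`, and both terms lift, so no constant has to be subtracted.
    refine ⟨0, fun w => H1.mul (N w) (N' w) + k • N' w, ?_⟩
    convert (h.mul h').add (h'.smul k) using 3
    simp only [map_mul, MvPolynomial.eval_X]; ring

theorem exists_isLift {G : ℂ → ℂ → ℂ} (P : MvPolynomial (Fin 4) ℂ)
    (hP : ∀ u v, G u v = MvPolynomial.eval ![u, v, star u, star v] P) (h0 : G 0 0 = 0) :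
    ∃ N, IsLift G N := by
  obtain ⟨k, N, h⟩ := exists_isLift_sub_const P
  have hk := h.apply_zero
  rw [← hP, h0, zero_sub, neg_eq_zero] at hk
  refine ⟨N, ?_⟩
  convert h using 3
  rw [hP, hk, sub_zero]

/-! ### Global ordinary differential equations and radial truncation. -/

theorem exists_global_solution_of_bounded {X : Type*} [NormedAddCommGroup X] [NormedSpace ℝ X]
    [CompleteSpace X] (f : ℝ → X → X) (x₀ : X)
    (hlip : ∀ T : ℝ, ∃ K : ℝ≥0, ∀ t ∈ Icc 0 T, LipschitzWith K (f t))
    (hbdd : ∀ T : ℝ, ∃ B : ℝ≥0, ∀ t ∈ Icc 0 T, ∀ x, ‖f t x‖ ≤ B)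
    (hcont : ∀ x, ContinuousOn (fun t => f t x) (Ici 0)) :
    ∃ α : ℝ → X, α 0 = x₀ ∧ ∀ t ∈ Ici (0 : ℝ), HasDerivWithinAt α (f t (α t)) (Ici 0) t := by
  have hloc : ∀ n : ℕ, ∃ α : ℝ → X, α 0 = x₀ ∧
      ∀ t ∈ Icc (0 : ℝ) (n + 1), HasDerivWithinAt α (f t (α t)) (Icc 0 (n + 1)) t := by
    intro n
    obtain ⟨K, hK⟩ := hlip (n + 1)
    obtain ⟨B, hB⟩ := hbdd (n + 1)
    have hn : (0 : ℝ) ≤ n + 1 := by positivity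
    -- With speed at most `B`, a trajectory stays in the ball of radius `B * (n + 1)` throughout
    -- `[0, n + 1]`, so Picard–Lindelöf applies to the whole interval at once.
    have hPL : IsPicardLindelof f (tmin := 0) (tmax := n + 1) ⟨0, left_mem_Icc.2 hn⟩ x₀
        (B * (n + 1)) 0 B K :=
      { lipschitzOnWith := fun t ht => (hK t ht).lipschitzOnWith
        continuousOn := fun x _ => (hcont x).mono Icc_subset_Ici_self
        norm_le := fun t ht x _ => hB t ht x
        mul_max_le := by simp [hn] }
    exact hPL.exists_eq_forall_mem_Icc_hasDerivWithinAt₀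
  choose α hα0 hα using hloc
  have huniq : ∀ n m : ℕ, n ≤ m → EqOn (α n) (α m) (Icc 0 (n + 1)) := by
    intro n m hnm
    have hnm' : (n : ℝ) + 1 ≤ m + 1 := by exact_mod_cast Nat.succ_le_succ hnm
    obtain ⟨K, hK⟩ := hlip (n + 1)
    have hright : ∀ k : ℕ, n ≤ k → ∀ t ∈ Ico (0 : ℝ) (n + 1),
        HasDerivWithinAt (α k) (f t (α k t)) (Ici t) t := by
      intro k hk t ht
      have hk' : (n : ℝ) + 1 ≤ k + 1 := by exact_mod_cast Nat.succ_le_succ hk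
      refine (hα k t ⟨ht.1, ht.2.le.trans hk'⟩).mono_of_mem_nhdsWithin ?_
      exact Filter.mem_of_superset (Icc_mem_nhdsGE (ht.2.trans_le hk'))
        (Icc_subset_Icc_left ht.1)
    refine ODE_solution_unique_of_mem_Icc_right (K := K) (v := f) (s := fun _ => univ)
      (fun t ht => (hK t (Ico_subset_Icc_self ht)).lipschitzOnWith)
      (fun t ht => (hα n t ht).continuousWithinAt) (hright n le_rfl) (fun _ _ => trivial)
      (fun t ht => ((hα m t ⟨ht.1, ht.2.trans hnm'⟩).continuousWithinAt).mono
        (Icc_subset_Icc_right hnm')) (hright m hnm) (fun _ _ => trivial) ?_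
    rw [hα0, hα0]
  -- The solution of index `⌊t⌋₊` lives on `[0, ⌊t⌋₊ + 1]`, a neighbourhood of `t` in `[0, ∞)`;
  -- nearby times below `⌊t⌋₊ + 1` have no larger index, and uniqueness identifies the solutions.
  refine ⟨fun t => α ⌊t⌋₊ t, by simp [hα0], fun t ht => ?_⟩
  have ht0 : (0 : ℝ) ≤ t := ht
  have hlt := Nat.lt_floor_add_one t
  have h1 : HasDerivWithinAt (α ⌊t⌋₊) (f t (α ⌊t⌋₊ t)) (Ici 0) t := by
    refine (hα ⌊t⌋₊ t ⟨ht0, hlt.le⟩).mono_of_mem_nhdsWithin ?_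
    rw [← Ici_inter_Iic]
    exact Filter.inter_mem self_mem_nhdsWithin (mem_nhdsWithin_of_mem_nhds (Iic_mem_nhds hlt))
  refine h1.congr_of_eventuallyEq ?_ rfl
  have h2 : Iio ((⌊t⌋₊ : ℝ) + 1) ∈ 𝓝[Ici 0] t := mem_nhdsWithin_of_mem_nhds (Iio_mem_nhds hlt)
  filter_upwards [h2, self_mem_nhdsWithin] with s hs1 hs2
  have hs0 : (0 : ℝ) ≤ s := hs2
  refine huniq _ _ ?_ ⟨hs0, (Nat.lt_floor_add_one s).le⟩
  have : (⌊s⌋₊ : ℝ) < ⌊t⌋₊ + 1 := (Nat.floor_le hs0).trans_lt hs1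
  exact Nat.lt_succ_iff.1 (by exact_mod_cast this)

/-- The scalar by which the radial projection onto the ball of radius `r` multiplies `w`. -/
def truncFactor {X : Type*} [NormedAddCommGroup X] (r : ℝ) (w : X) : ℝ := r / max r ‖w‖

section Trunc

variable {X : Type*} [NormedAddCommGroup X] {r : ℝ}

theorem truncFactor_pos (hr : 0 < r) (w : X) : 0 < truncFactor r w :=
  div_pos hr (lt_max_of_lt_left hr)

theorem truncFactor_le_one (hr : 0 < r) (w : X) : truncFactor r w ≤ 1 :=
  (div_le_one (lt_max_of_lt_left hr)).2 (le_max_left _ _)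

theorem truncFactor_eq_one (hr : 0 < r) {w : X} (hw : ‖w‖ ≤ r) : truncFactor r w = 1 := by
  rw [truncFactor, max_eq_left hw, div_self hr.ne']

theorem truncFactor_mul_norm_le (hr : 0 < r) (w : X) : truncFactor r w * ‖w‖ ≤ r := by
  rw [truncFactor, div_mul_eq_mul_div, div_le_iff₀ (lt_max_of_lt_left hr)]
  exact mul_le_mul_of_nonneg_left (le_max_right _ _) hr.le

variable [NormedSpace ℂ X]

/-- The radial projection onto the ball of radius `r`. -/
def trunc (r : ℝ) (w : X) : X := (truncFactor r w : ℂ) • w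

theorem norm_trunc_le (hr : 0 < r) (w : X) : ‖trunc r w‖ ≤ r := by
  rw [trunc, norm_smul, Complex.norm_real, Real.norm_of_nonneg (truncFactor_pos hr w).le]
  exact truncFactor_mul_norm_le hr w

theorem norm_trunc_le_norm (hr : 0 < r) (w : X) : ‖trunc r w‖ ≤ ‖w‖ := by
  rw [trunc, norm_smul, Complex.norm_real, Real.norm_of_nonneg (truncFactor_pos hr w).le]
  exact mul_le_of_le_one_left (norm_nonneg _) (truncFactor_le_one hr w)

theorem trunc_eq_self (hr : 0 < r) {w : X} (hw : ‖w‖ ≤ r) : trunc r w = w := by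
  rw [trunc, truncFactor_eq_one hr hw, Complex.ofReal_one, one_smul]

/-- One copy of `‖w - w'‖` comes from scaling the difference, the other from the change of the
scalar factor; the constant 2 holds in any normed space. -/
theorem norm_trunc_sub_trunc_le (hr : 0 < r) (w w' : X) :
    ‖trunc r w - trunc r w'‖ ≤ 2 * ‖w - w'‖ := by
  have hm : 0 < max r ‖w‖ := lt_max_of_lt_left hr
  have hm' : 0 < max r ‖w'‖ := lt_max_of_lt_left hr
  have e : trunc r w - trunc r w' = (truncFactor r w : ℂ) • (w - w') +
      ((truncFactor r w - truncFactor r w' : ℝ) : ℂ) • w' := by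
    rw [trunc, trunc, Complex.ofReal_sub, sub_smul, smul_sub]; abel
  have h1 : ‖(truncFactor r w : ℂ) • (w - w')‖ ≤ ‖w - w'‖ := by
    rw [norm_smul, Complex.norm_real, Real.norm_of_nonneg (truncFactor_pos hr w).le]
    exact mul_le_of_le_one_left (norm_nonneg _) (truncFactor_le_one hr w)
  have h2 : ‖((truncFactor r w - truncFactor r w' : ℝ) : ℂ) • w'‖ ≤ ‖w - w'‖ := by
    rw [norm_smul, Complex.norm_real, Real.norm_eq_abs]
    have e2 : truncFactor r w - truncFactor r w' =
        r / max r ‖w‖ * ((max r ‖w'‖ - max r ‖w‖) / max r ‖w'‖) := by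
      rw [truncFactor, truncFactor]; field_simp
    have e3 : |max r ‖w'‖ - max r ‖w‖| ≤ ‖w - w'‖ := by
      refine (abs_max_sub_max_le_max _ _ _ _).trans ?_
      rw [sub_self, abs_zero, max_eq_right (abs_nonneg _), abs_sub_comm]
      exact abs_norm_sub_norm_le w w'
    rw [e2, abs_mul, abs_of_pos (div_pos hr hm), abs_div, abs_of_pos hm', mul_assoc]
    refine (mul_le_of_le_one_left (by positivity) (truncFactor_le_one hr w)).trans ?_
    rw [div_mul_eq_mul_div, div_le_iff₀ hm']
    exact mul_le_mul e3 (le_max_right _ _) (norm_nonneg _) (norm_nonneg _)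
  rw [e, two_mul]
  exact (norm_add_le _ _).trans (add_le_add h1 h2)

theorem continuous_trunc {ρ : ℝ → ℝ} (hρ : Continuous ρ) (h0 : ∀ t, 0 < ρ t) (w : X) :
    Continuous fun t => trunc (ρ t) w := by
  have : Continuous fun t => truncFactor (ρ t) w :=
    hρ.div (hρ.max continuous_const) fun t => (lt_max_of_lt_left (h0 t)).ne'
  exact (Complex.continuous_ofReal.comp this).smul continuous_const

end Trunc

/-! ### The transport estimate for the densities. -/

theorem intervalIntegrable_of_continuousOn_Ici {β : ℝ → ℝ} (hβ : ContinuousOn β (Ici 0))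
    {s t : ℝ} (hs : 0 ≤ s) (ht : 0 ≤ t) : IntervalIntegrable β volume s t :=
  (hβ.mono fun _ hx => (le_min hs ht).trans hx.1).intervalIntegrable

/-- Gronwall with a variable coefficient: `a` times the integrating factor `exp (-k ∫ β)` is
nonincreasing. -/
theorem le_mul_exp_integral {k : ℝ} {a a' β : ℝ → ℝ}
    (ha : ∀ t ∈ Ici (0 : ℝ), HasDerivWithinAt a (a' t) (Ici 0) t) (hβ : ContinuousOn β (Ici 0))
    (hle : ∀ t ∈ Ici (0 : ℝ), a' t ≤ k * a t * β t) {t : ℝ} (ht : 0 ≤ t) :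
    a t ≤ a 0 * Real.exp (k * ∫ s in (0:ℝ)..t, β s) := by
  -- Extending `β` by its value at 0 makes the primitive differentiable on both sides everywhere.
  set γ : ℝ → ℝ := fun s => β (max s 0)
  have hγ : Continuous γ :=
    hβ.comp_continuous (by fun_prop) fun s => le_max_right s 0
  have hγβ : ∀ s, 0 ≤ s → γ s = β s := fun s hs => by simp [γ, hs]
  have hB : ∀ s, HasDerivAt (fun r => ∫ x in (0:ℝ)..r, γ x) (γ s) s := fun s =>
    intervalIntegral.integral_hasDerivAt_right (hγ.intervalIntegrable _ _)
      (hγ.stronglyMeasurableAtFilter _ _) hγ.continuousAt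
  have hd : ∀ s ∈ Ici (0 : ℝ), HasDerivWithinAt
      (fun r => a r * Real.exp (-(k * ∫ x in (0:ℝ)..r, γ x)))
      (a' s * Real.exp (-(k * ∫ x in (0:ℝ)..s, γ x)) +
        a s * (Real.exp (-(k * ∫ x in (0:ℝ)..s, γ x)) * (-(k * γ s)))) (Ici 0) s := fun s hs =>
    (ha s hs).mul (((hB s).const_mul k).neg.exp.hasDerivWithinAt)
  have hanti : AntitoneOn (fun r => a r * Real.exp (-(k * ∫ x in (0:ℝ)..r, γ x))) (Ici 0) := by
    refine antitoneOn_of_hasDerivWithinAt_nonpos (convex_Ici 0)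
      (fun s hs => (hd s hs).continuousWithinAt)
      (fun s hs => (hd s (interior_subset hs)).mono interior_subset) fun s hs => ?_
    have hs' : s ∈ Ici (0 : ℝ) := interior_subset hs
    have h1 := hle s hs'
    rw [← hγβ s hs'] at h1
    have h2 := Real.exp_pos (-(k * ∫ x in (0:ℝ)..s, γ x))
    nlinarith
  have h := hanti (mem_Ici.2 le_rfl) (mem_Ici.2 ht) ht
  have hint : ∫ s in (0:ℝ)..t, γ s = ∫ s in (0:ℝ)..t, β s :=
    intervalIntegral.integral_congr fun s hs => hγβ s (by
      rw [uIcc_of_le ht] at hs; exact hs.1)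
  simp only [intervalIntegral.integral_same, mul_zero, neg_zero, Real.exp_zero, mul_one,
    hint] at h
  rw [Real.exp_neg, ← div_eq_mul_inv, div_le_iff₀ (Real.exp_pos _)] at h
  exact h

/-- Two densities transported along opposite characteristics, with a quadratic interaction and
small total masses, at most double along their characteristics. -/
theorem transport_le_two_mul {c μ : ℝ} (hc : 0 ≤ c) (hμ : 0 < μ)
    (hcμ : Real.exp (2 * c * (2 * μ)) ≤ 2) {a b a' b' : ℝ → ℝ → ℝ}
    (ha0 : ∀ t y, 0 ≤ a t y) (hb0 : ∀ t y, 0 ≤ b t y)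
    (hda : ∀ y, ∀ t ∈ Ici (0 : ℝ), HasDerivWithinAt (fun s => a s y) (a' t y) (Ici 0) t)
    (hdb : ∀ y, ∀ t ∈ Ici (0 : ℝ), HasDerivWithinAt (fun s => b s y) (b' t y) (Ici 0) t)
    (hla : ∀ y, ∀ t ∈ Ici (0 : ℝ), a' t y ≤ 2 * c * a t y * b t (y + 2 * t))
    (hlb : ∀ y, ∀ t ∈ Ici (0 : ℝ), b' t y ≤ 2 * c * b t y * a t (y - 2 * t))
    (hcb : ∀ y, ContinuousOn (fun s => b s (y + 2 * s)) (Ici 0))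
    (hca : ∀ y, ContinuousOn (fun s => a s (y - 2 * s)) (Ici 0))
    (hbdd : ∀ T : ℝ, ∃ K, ∀ t ∈ Icc 0 T, ∀ y, a t y ≤ K ∧ b t y ≤ K)
    (hib : ∀ y, Continuous fun s => b 0 (y + 2 * s))
    (hia : ∀ y, Continuous fun s => a 0 (y - 2 * s))
    (hmb : ∀ y t, 0 ≤ t → ∫ s in (0:ℝ)..t, b 0 (y + 2 * s) ≤ μ / 2)
    (hma : ∀ y t, 0 ≤ t → ∫ s in (0:ℝ)..t, a 0 (y - 2 * s) ≤ μ / 2)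
    {t : ℝ} (ht : 0 ≤ t) (y : ℝ) : a t y ≤ 2 * a 0 y ∧ b t y ≤ 2 * b 0 y := by
  have hA : ∀ r y, 0 ≤ r → ∫ s in (0:ℝ)..r, b s (y + 2 * s) ≤ 2 * μ → a r y ≤ 2 * a 0 y := by
    intro r y hr hi
    refine (le_mul_exp_integral (hda y) (hcb y) (hla y) hr).trans ?_
    rw [mul_comm]
    refine mul_le_mul_of_nonneg_right (le_trans (Real.exp_le_exp.2 ?_) hcμ) (ha0 _ _)
    exact mul_le_mul_of_nonneg_left hi (by positivity)
  have hB : ∀ r y, 0 ≤ r → ∫ s in (0:ℝ)..r, a s (y - 2 * s) ≤ 2 * μ → b r y ≤ 2 * b 0 y := by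
    intro r y hr hi
    refine (le_mul_exp_integral (hdb y) (hca y) (hlb y) hr).trans ?_
    rw [mul_comm]
    refine mul_le_mul_of_nonneg_right (le_trans (Real.exp_le_exp.2 ?_) hcμ) (hb0 _ _)
    exact mul_le_mul_of_nonneg_left hi (by positivity)
  obtain ⟨K₀, hK₀⟩ := hbdd t
  set K := max K₀ 1
  have hK1 : 0 < K := lt_max_of_lt_right one_pos
  have hK : ∀ s ∈ Icc 0 t, ∀ y, a s y ≤ K ∧ b s y ≤ K := fun s hs y =>
    ⟨(hK₀ s hs y).1.trans (le_max_left _ _), (hK₀ s hs y).2.trans (le_max_left _ _)⟩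
  -- Over a time `h` an integrand bounded by `K` adds at most `μ`, so a bound `μ` degrades to no
  -- worse than `2μ`. This replaces a continuity argument by an induction with steps of fixed
  -- length.
  set h := μ / K
  have hh : 0 < h := div_pos hμ hK1
  have step : ∀ (β : ℝ → ℝ) (_ : ContinuousOn β (Ici 0)) (_ : ∀ s ∈ Icc 0 t, β s ≤ K)
      (τ r : ℝ), 0 ≤ τ → τ ≤ r → r ≤ t → r ≤ τ + h → ∫ s in (0:ℝ)..τ, β s ≤ μ →
      ∫ s in (0:ℝ)..r, β s ≤ 2 * μ := by
    intro β hβ hβK τ r h0 h1 h2 h3 h4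
    rw [← intervalIntegral.integral_add_adjacent_intervals
      (intervalIntegrable_of_continuousOn_Ici hβ le_rfl h0)
      (intervalIntegrable_of_continuousOn_Ici hβ h0 (h0.trans h1))]
    have h5 : ∫ s in τ..r, β s ≤ ∫ _ in τ..r, K :=
      intervalIntegral.integral_mono_on h1
        (intervalIntegrable_of_continuousOn_Ici hβ h0 (h0.trans h1))
        (intervalIntegrable_const) fun s hs => hβK s ⟨h0.trans hs.1, hs.2.trans h2⟩
    rw [intervalIntegral.integral_const, smul_eq_mul] at h5
    have h6 : (r - τ) * K ≤ μ := by
      rw [← le_div_iff₀ hK1]; linarith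
    linarith
  have claim : ∀ n : ℕ, ∀ r, 0 ≤ r → r ≤ t → r ≤ n * h → ∀ y,
      ∫ s in (0:ℝ)..r, b s (y + 2 * s) ≤ μ ∧ ∫ s in (0:ℝ)..r, a s (y - 2 * s) ≤ μ := by
    intro n
    induction n with
    | zero =>
      intro r h0 _ h1 y
      have : r = 0 := le_antisymm (by simpa using h1) h0
      simp [this, hμ.le]
    | succ n ih =>
      have hnh : 0 ≤ n * h := by positivity
      -- The inductive bound `μ` at time `min r (n * h)` gives the provisional bound `2μ` one step
      -- later.
      have weak : ∀ r, 0 ≤ r → r ≤ t → r ≤ (n + 1 : ℕ) * h → ∀ y,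
          ∫ s in (0:ℝ)..r, b s (y + 2 * s) ≤ 2 * μ ∧
          ∫ s in (0:ℝ)..r, a s (y - 2 * s) ≤ 2 * μ := by
        intro r h0 h1 h2 y
        have h3 : r ≤ min r (n * h) + h := by
          push_cast at h2
          rcases le_total r (n * h) with h | h
          · rw [min_eq_left h]; linarith
          · rw [min_eq_right h]; linarith
        obtain ⟨i1, i2⟩ := ih (min r (n * h)) (le_min h0 hnh) ((min_le_left _ _).trans h1)
          (min_le_right _ _) y
        exact ⟨step _ (hcb y) (fun s hs => (hK s hs _).2) _ r (le_min h0 hnh) (min_le_left _ _)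
            h1 h3 i1,
          step _ (hca y) (fun s hs => (hK s hs _).1) _ r (le_min h0 hnh) (min_le_left _ _)
            h1 h3 i2⟩
      -- The provisional bound yields doubling on every opposite characteristic up to time `r`;
      -- integrating the doubled initial density, whose integral is at most `μ / 2`, restores the
      -- bound `μ`.
      intro r h0 h1 h2 y
      constructor
      · calc ∫ s in (0:ℝ)..r, b s (y + 2 * s) ≤ ∫ s in (0:ℝ)..r, 2 * b 0 (y + 2 * s) := by
              refine intervalIntegral.integral_mono_on h0
                (intervalIntegrable_of_continuousOn_Ici (hcb y) le_rfl h0)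
                (((hib y).const_mul 2).intervalIntegrable _ _) fun s hs => ?_
              exact hB s _ hs.1 (weak s hs.1 (hs.2.trans h1) (hs.2.trans h2) _).2
          _ ≤ μ := by
              rw [intervalIntegral.integral_const_mul]
              linarith [hmb y r h0]
      · calc ∫ s in (0:ℝ)..r, a s (y - 2 * s) ≤ ∫ s in (0:ℝ)..r, 2 * a 0 (y - 2 * s) := by
              refine intervalIntegral.integral_mono_on h0
                (intervalIntegrable_of_continuousOn_Ici (hca y) le_rfl h0)
                (((hia y).const_mul 2).intervalIntegrable _ _) fun s hs => ?_
              exact hA s _ hs.1 (weak s hs.1 (hs.2.trans h1) (hs.2.trans h2) _).1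
          _ ≤ μ := by
              rw [intervalIntegral.integral_const_mul]
              linarith [hma y r h0]
  obtain ⟨n, hn⟩ := exists_nat_ge (t / h)
  have hn' : t ≤ n * h := (div_le_iff₀ hh).1 hn
  obtain ⟨h1, h2⟩ := claim n t ht le_rfl hn' y
  exact ⟨hA t y ht (h1.trans (by linarith)), hB t y ht (h2.trans (by linarith))⟩

/-! ### Algebraic structure of the nonlinearity. -/

theorem hasDerivAt_eval_curve {σ : Type*} [DecidableEq σ] (Q : MvPolynomial σ ℝ) (i : σ)
    {γ : ℝ → σ → ℝ} {s : ℝ}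
    (hγ : ∀ j, HasDerivAt (fun r => γ r j) ((Pi.single i 1 : σ → ℝ) j) s) :
    HasDerivAt (fun r => MvPolynomial.eval (γ r) Q)
      (MvPolynomial.eval (γ s) (MvPolynomial.pderiv i Q)) s := by
  induction Q using MvPolynomial.induction_on with
  | C a => simpa using hasDerivAt_const s a
  | add p q hp hq => simpa using hp.fun_add hq
  | mul_X p j hp =>
    have := hp.fun_mul (hγ j)
    simp only [map_mul, MvPolynomial.eval_X, Derivation.leibniz, MvPolynomial.pderiv_X,
      map_add, smul_eq_mul]
    refine this.congr_deriv ?_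
    by_cases h : j = i
    · subst h; simp; ring
    · simp [Pi.single_eq_of_ne h]; ring

/-- The chain rule, with `∂|z|²/∂z̄ = z`. Since `g'` is real, this part of the field only rotates
the phase. -/
theorem wirtingerBar_comp_norm_sq {g : ℝ → ℝ} {g' : ℝ} {u : ℂ} (hg : HasDerivAt g g' (‖u‖ ^ 2)) :
    wirtingerBar (fun z => ((g (‖z‖ ^ 2) : ℝ) : ℂ)) u = g' * u := by
  have h1 := hg.comp_hasFDerivAt u (hasStrictFDerivAt_norm_sq u).hasFDerivAt
  have h2 := Complex.ofRealCLM.hasFDerivAt.comp u h1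
  have h3 : fderiv ℝ (fun z : ℂ => ((g (‖z‖ ^ 2) : ℝ) : ℂ)) u = _ := h2.fderiv
  rw [wirtingerBar, h3]
  apply Complex.ext <;> simp [Complex.inner] <;> ring

/-- The gradient part of the nonlinearity is a real multiple, polynomial in the moduli, of each
component. -/
theorem wirtingerBar_polynomialInModuli {W : ℂ → ℂ → ℝ} (hW : IsPolynomialInModuli W) :
    ∃ Q₁ Q₂ : MvPolynomial (Fin 2) ℝ,
      (∀ u v, wirtingerBar (fun z => (W z v : ℂ)) u =
        ((MvPolynomial.eval ![‖u‖ ^ 2, ‖v‖ ^ 2] Q₁ : ℝ) : ℂ) * u) ∧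
      ∀ u v, wirtingerBar (fun z => (W u z : ℂ)) v =
        ((MvPolynomial.eval ![‖u‖ ^ 2, ‖v‖ ^ 2] Q₂ : ℝ) : ℂ) * v := by
  obtain ⟨P, hP⟩ := hW
  refine ⟨MvPolynomial.pderiv 0 P, MvPolynomial.pderiv 1 P, fun u v => ?_, fun u v => ?_⟩
  · simp only [hP]
    refine wirtingerBar_comp_norm_sq (g := fun s => MvPolynomial.eval ![s, ‖v‖ ^ 2] P)
      (hasDerivAt_eval_curve P 0 (γ := fun s => ![s, ‖v‖ ^ 2]) fun j => ?_)
    fin_cases j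
    · simpa using hasDerivAt_id' _
    · simpa using hasDerivAt_const _ _
  · simp only [hP]
    refine wirtingerBar_comp_norm_sq (g := fun s => MvPolynomial.eval ![‖u‖ ^ 2, s] P)
      (hasDerivAt_eval_curve P 1 (γ := fun s => ![‖u‖ ^ 2, s]) fun j => ?_)
    fin_cases j
    · simpa using hasDerivAt_const _ _
    · simpa using hasDerivAt_id' _

/-- A real polynomial in the moduli as a polynomial in the variables and their conjugates. -/
def moduliPolynomial (Q : MvPolynomial (Fin 2) ℝ) : MvPolynomial (Fin 4) ℂ :=
  MvPolynomial.bind₁ ![MvPolynomial.X 0 * MvPolynomial.X 2, MvPolynomial.X 1 * MvPolynomial.X 3]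
    (MvPolynomial.map Complex.ofRealHom Q)

theorem eval_moduliPolynomial (Q : MvPolynomial (Fin 2) ℝ) (u v : ℂ) :
    MvPolynomial.eval ![u, v, star u, star v] (moduliPolynomial Q) =
      ((MvPolynomial.eval ![‖u‖ ^ 2, ‖v‖ ^ 2] Q : ℝ) : ℂ) := by
  have hn : ∀ z : ℂ, z * star z = ((‖z‖ ^ 2 : ℝ) : ℂ) := fun z => by
    rw [← Complex.normSq_eq_norm_sq]; exact Complex.mul_conj z
  induction Q using MvPolynomial.induction_on with
  | C a => simp [moduliPolynomial]
  | add p q hp hq => simp_all [moduliPolynomial]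
  | mul_X p i hp =>
    have : MvPolynomial.eval ![u, v, star u, star v] (moduliPolynomial (MvPolynomial.X i)) =
        (((![‖u‖ ^ 2, ‖v‖ ^ 2] : Fin 2 → ℝ) i : ℝ) : ℂ) := by
      fin_cases i
      · simpa [moduliPolynomial] using hn u
      · simpa [moduliPolynomial] using hn v
    have hmul : moduliPolynomial (p * MvPolynomial.X i) =
        moduliPolynomial p * moduliPolynomial (MvPolynomial.X i) := by
      simp only [moduliPolynomial, map_mul]
    rw [hmul, map_mul, hp, this]
    simp

theorem exists_isLift_of_eq {Q : MvPolynomial (Fin 2) ℝ} {F G : ℂ → ℂ → ℂ}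
    (hF : IsCubicPolynomial F) (i : Fin 4)
    (hG : ∀ u v, G u v = ((MvPolynomial.eval ![‖u‖ ^ 2, ‖v‖ ^ 2] Q : ℝ) : ℂ) *
      (![u, v, star u, star v] : Fin 4 → ℂ) i + F u v) (h0 : F 0 0 = 0) :
    ∃ N, IsLift G N := by
  obtain ⟨P, -, hP⟩ := hF
  refine exists_isLift (moduliPolynomial Q * MvPolynomial.X i + P) (fun u v => ?_) ?_
  · rw [hG, hP, map_add, map_mul, eval_moduliPolynomial, MvPolynomial.eval_X]
  · rw [hG, h0]
    fin_cases i <;> simp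

theorem IsCubicPolynomial.continuous {F : ℂ → ℂ → ℂ} (hF : IsCubicPolynomial F) :
    Continuous fun p : ℂ × ℂ => F p.1 p.2 := by
  obtain ⟨P, -, hP⟩ := hF
  simp only [hP]
  refine (MvPolynomial.continuous_eval P).comp (continuous_pi fun i => ?_)
  fin_cases i <;> simp <;> fun_prop

/-- The right side is zero, so `f` vanishes off the origin and, by continuity, at it. This gives `F₁
0 0 = F₂ 0 0 = 0`, without which the nonlinearity would not map into `H¹`. -/
theorem eq_zero_of_mul_bound {f : ℂ → ℂ} {c : ℝ} (hf : Continuous f)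
    (h : ∀ u, ‖u‖ * ‖f u‖ ≤ c * ‖u‖ ^ 2 * ‖(0 : ℂ)‖ ^ 2) : f 0 = 0 := by
  have h1 : ∀ u ∈ ({0}ᶜ : Set ℂ), f u = 0 := by
    intro u hu
    have := h u
    have h2 : ‖u‖ * ‖f u‖ = 0 := le_antisymm (by simpa using this) (by positivity)
    rcases mul_eq_zero.1 h2 with h3 | h3
    · exact absurd (norm_eq_zero.1 h3) hu
    · exact norm_eq_zero.1 h3
  have h2 : f = fun _ => 0 :=
    Continuous.ext_on (dense_compl_singleton (0 : ℂ)) hf continuous_const h1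
  exact congrFun h2 0

/-- The term with real `D` contributes `-i D l |u|²`, which has no real part. Dividing the
hypothesis on `f` by `l` leaves a factor `l³ ≤ 1`, so truncation preserves the density inequality
with the same `c`. -/
theorem two_mul_inner_le {c D l : ℝ} {u v : ℂ} (hl : 0 < l) (hl1 : l ≤ 1)
    {f : ℂ} (hf : ‖star ((l : ℂ) * u) * f‖ ≤ c * ‖(l : ℂ) * u‖ ^ 2 * ‖(l : ℂ) * v‖ ^ 2)
    (hc : 0 ≤ c) :
    2 * inner ℝ u (-Complex.I * ((D : ℂ) * ((l : ℂ) * u) + f)) ≤ 2 * c * ‖u‖ ^ 2 * ‖v‖ ^ 2 := by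
  have e : inner ℝ u (-Complex.I * ((D : ℂ) * ((l : ℂ) * u) + f)) =
      (-Complex.I * (star u * f)).re := by
    simp [Complex.inner]; ring
  have h1 : (-Complex.I * (star u * f)).re ≤ ‖u‖ * ‖f‖ := by
    refine (Complex.re_le_norm _).trans ?_
    simp
  have h2 : l * (‖u‖ * ‖f‖) ≤ l * (c * l ^ 3 * ‖u‖ ^ 2 * ‖v‖ ^ 2) := by
    simp only [norm_mul, norm_star, Complex.norm_real, Real.norm_of_nonneg hl.le] at hf
    nlinarith
  have h3 := le_of_mul_le_mul_left h2 hl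
  have h4 : c * l ^ 3 * ‖u‖ ^ 2 * ‖v‖ ^ 2 ≤ c * 1 * ‖u‖ ^ 2 * ‖v‖ ^ 2 := by
    gcongr
    exact pow_le_one₀ hl.le hl1
  rw [e]
  linarith

open H1

/-! ### Characteristic coordinates and the truncated field. -/

/-- Passage from characteristic coordinates to physical ones at time `t`. -/
def toPhys (t : ℝ) (w : H1 × H1) : H1 × H1 := (H1.shift (-t) w.1, H1.shift t w.2)

theorem norm_toPhys (t : ℝ) (w : H1 × H1) : ‖toPhys t w‖ = ‖w‖ := by
  simp [toPhys, Prod.norm_def]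

theorem toPhys_sub (t : ℝ) (w w' : H1 × H1) : toPhys t (w - w') = toPhys t w - toPhys t w' := by
  simp [toPhys]

theorem toPhys_zero (w : H1 × H1) : toPhys 0 w = w := by
  simp [toPhys, H1.shift_zero]

theorem continuous_toPhys : Continuous fun p : ℝ × (H1 × H1) => toPhys p.1 p.2 := by
  refine Continuous.prodMk ?_ ?_
  · exact H1.continuous_shift.comp (continuous_fst.neg.prodMk continuous_snd.fst)
  · exact H1.continuous_shift.comp (continuous_fst.prodMk continuous_snd.snd)

theorem value_toPhys_fst (t x : ℝ) (w : H1 × H1) :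
    value x (toPhys t w).1 = value (x - t) w.1 := by
  rw [toPhys, value_shift, sub_eq_add_neg]

theorem value_toPhys_snd (t x : ℝ) (w : H1 × H1) :
    value x (toPhys t w).2 = value (x + t) w.2 := by
  rw [toPhys, value_shift]

theorem IsLift.continuous {G : ℂ → ℂ → ℂ} {N : H1 × H1 → H1} (h : IsLift G N) :
    Continuous N := by
  refine continuous_iff_continuousAt.2 fun w => ?_
  obtain ⟨K, hK, H⟩ := h.lipschitz (‖w‖ + 1)
  have hL : LipschitzOnWith ⟨K, hK⟩ N (Metric.closedBall 0 (‖w‖ + 1)) :=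
    LipschitzOnWith.of_dist_le_mul fun x hx y hy => by
      rw [dist_eq_norm, dist_eq_norm]
      exact H x y (mem_closedBall_zero_iff.1 hx) (mem_closedBall_zero_iff.1 hy)
  refine hL.continuousOn.continuousAt ?_
  refine Filter.mem_of_superset (Metric.isOpen_ball.mem_nhds (x := w) ?_)
    Metric.ball_subset_closedBall
  simp

/-- The vector field of the system in characteristic coordinates, truncated radially at the
time dependent radius `ρ`. -/
def charField (N₁ N₂ : H1 × H1 → H1) (ρ : ℝ → ℝ) (t : ℝ) (w : H1 × H1) : H1 × H1 :=
  (-Complex.I) • toPhys (-t)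
    (N₁ (toPhys t (trunc (ρ t) w)), N₂ (toPhys t (trunc (ρ t) w)))

theorem continuous_fun_const_smul {X : Type*} [NormedAddCommGroup X] [NormedSpace ℂ X] (c : ℂ)
    {f : ℝ → X} (hf : Continuous f) : Continuous fun t => c • f t := hf.const_smul c

section Field

variable {G₁ G₂ : ℂ → ℂ → ℂ} {N₁ N₂ : H1 × H1 → H1} {ρ : ℝ → ℝ}

theorem norm_charField (t : ℝ) (w : H1 × H1) : ‖charField N₁ N₂ ρ t w‖ =
    max ‖N₁ (toPhys t (trunc (ρ t) w))‖ ‖N₂ (toPhys t (trunc (ρ t) w))‖ := by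
  rw [charField, norm_smul, norm_toPhys, norm_neg, Complex.norm_I, one_mul, Prod.norm_mk]

theorem norm_charField_sub (t : ℝ) (w w' : H1 × H1) :
    ‖charField N₁ N₂ ρ t w - charField N₁ N₂ ρ t w'‖ =
    max ‖N₁ (toPhys t (trunc (ρ t) w)) - N₁ (toPhys t (trunc (ρ t) w'))‖
      ‖N₂ (toPhys t (trunc (ρ t) w)) - N₂ (toPhys t (trunc (ρ t) w'))‖ := by
  rw [charField, charField, ← smul_sub, ← toPhys_sub, norm_smul, norm_toPhys, norm_neg,
    Complex.norm_I, one_mul, Prod.mk_sub_mk, Prod.norm_mk]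

/-- At frame position `y` the first component meets the second at `y + 2 * t`, the relative speed
being 2. Truncation enters only as a common real factor in both arguments. -/
theorem value_charField_fst (h₁ : IsLift G₁ N₁) (t y : ℝ) (w : H1 × H1) :
    value y (charField N₁ N₂ ρ t w).1 = -Complex.I *
      G₁ ((truncFactor (ρ t) w : ℂ) * value y w.1)
        ((truncFactor (ρ t) w : ℂ) * value (y + 2 * t) w.2) := by
  rw [charField, Prod.smul_fst, map_smul, value_toPhys_fst, h₁.value_eq, value_toPhys_fst,
    value_toPhys_snd, trunc, Prod.smul_fst, Prod.smul_snd, map_smul, map_smul]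
  simp only [smul_eq_mul]
  ring_nf

theorem value_charField_snd (h₂ : IsLift G₂ N₂) (t y : ℝ) (w : H1 × H1) :
    value y (charField N₁ N₂ ρ t w).2 = -Complex.I *
      G₂ ((truncFactor (ρ t) w : ℂ) * value (y - 2 * t) w.1)
        ((truncFactor (ρ t) w : ℂ) * value y w.2) := by
  rw [charField, Prod.smul_snd, map_smul, value_toPhys_snd, h₂.value_eq, value_toPhys_fst,
    value_toPhys_snd, trunc, Prod.smul_fst, Prod.smul_snd, map_smul, map_smul]
  simp only [smul_eq_mul]
  ring_nf

theorem continuous_charField (h₁ : IsLift G₁ N₁) (h₂ : IsLift G₂ N₂) (hρ : Continuous ρ)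
    (hpos : ∀ t, 0 < ρ t) (w : H1 × H1) : Continuous fun t => charField N₁ N₂ ρ t w := by
  have hc : Continuous fun t => toPhys t (trunc (ρ t) w) :=
    continuous_toPhys.comp (continuous_id.prodMk (continuous_trunc hρ hpos w))
  have hc' : Continuous fun t => toPhys (-t)
      (N₁ (toPhys t (trunc (ρ t) w)), N₂ (toPhys t (trunc (ρ t) w))) :=
    continuous_toPhys.comp (continuous_neg.prodMk
      ((h₁.continuous.comp hc).prodMk (h₂.continuous.comp hc)))
  exact continuous_fun_const_smul _ hc'

theorem exists_truncated_solution (h₁ : IsLift G₁ N₁) (h₂ : IsLift G₂ N₂) (hρ : Continuous ρ)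
    (hmono : Monotone ρ) (hpos : ∀ t, 0 < ρ t) (w₀ : H1 × H1) :
    ∃ w : ℝ → H1 × H1, w 0 = w₀ ∧ ∀ t ∈ Ici (0 : ℝ),
      HasDerivWithinAt w (charField N₁ N₂ ρ t (w t)) (Ici 0) t := by
  have hz : ∀ T, ∀ t ∈ Icc 0 T, ∀ w : H1 × H1, ‖toPhys t (trunc (ρ t) w)‖ ≤ ρ T :=
    fun T t ht w => by
      rw [norm_toPhys]; exact (norm_trunc_le (hpos t) w).trans (hmono ht.2)
  refine exists_global_solution_of_bounded (charField N₁ N₂ ρ) w₀ (fun T => ?_) (fun T => ?_)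
    fun w => ?_
  · obtain ⟨K₁, hK₁, H₁⟩ := h₁.lipschitz (ρ T)
    obtain ⟨K₂, hK₂, H₂⟩ := h₂.lipschitz (ρ T)
    have hK : 0 ≤ max K₁ K₂ * 2 := by positivity
    refine ⟨(max K₁ K₂ * 2).toNNReal, fun t ht => LipschitzWith.of_dist_le_mul fun w w' => ?_⟩
    rw [dist_eq_norm, dist_eq_norm, norm_charField_sub]
    have hd : ‖toPhys t (trunc (ρ t) w) - toPhys t (trunc (ρ t) w')‖ ≤ 2 * ‖w - w'‖ := by
      rw [← toPhys_sub, norm_toPhys]; exact norm_trunc_sub_trunc_le (hpos t) w w'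
    rw [Real.coe_toNNReal _ hK, mul_assoc]
    refine max_le ?_ ?_
    · exact (H₁ _ _ (hz T t ht w) (hz T t ht w')).trans
        (mul_le_mul (le_max_left _ _) hd (norm_nonneg _) (by positivity))
    · exact (H₂ _ _ (hz T t ht w) (hz T t ht w')).trans
        (mul_le_mul (le_max_right _ _) hd (norm_nonneg _) (by positivity))
  · obtain ⟨B₁, hB₁, H₁⟩ := h₁.bounded (ρ T)
    obtain ⟨B₂, hB₂, H₂⟩ := h₂.bounded (ρ T)
    refine ⟨⟨max B₁ B₂, by positivity⟩, fun t ht w => ?_⟩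
    rw [norm_charField]
    exact max_le_max (H₁ _ (hz T t ht w)) (H₂ _ (hz T t ht w))
  · exact (continuous_charField h₁ h₂ hρ hpos w).continuousOn

/-- The truncation factor is at most 1, so it increases neither sup norms nor the `H¹` norm, and the
growth constant is independent of `ρ`. This lets `ρ` be chosen afterwards. -/
theorem norm_charField_le {R C₁ C₂ : ℝ} (hpos : ∀ t, 0 < ρ t) (hC₁ : 0 ≤ C₁)
    (H₁ : ∀ w : H1 × H1, ‖rep w.1‖ ≤ R → ‖rep w.2‖ ≤ R → ‖N₁ w‖ ≤ C₁ * ‖w‖)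
    (H₂ : ∀ w : H1 × H1, ‖rep w.1‖ ≤ R → ‖rep w.2‖ ≤ R → ‖N₂ w‖ ≤ C₂ * ‖w‖)
    {t : ℝ} {w : H1 × H1}
    (hw₁ : ∀ y, ‖value y w.1‖ ≤ R) (hw₂ : ∀ y, ‖value y w.2‖ ≤ R) :
    ‖charField N₁ N₂ ρ t w‖ ≤ max C₁ C₂ * ‖w‖ := by
  have hR : 0 ≤ R := (norm_nonneg _).trans (hw₁ 0)
  set z := toPhys t (trunc (ρ t) w)
  have hz : ‖z‖ ≤ ‖w‖ := by
    rw [norm_toPhys]; exact norm_trunc_le_norm (hpos t) w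
  have hl : ‖(truncFactor (ρ t) w : ℂ)‖ ≤ 1 := by
    rw [Complex.norm_real, Real.norm_of_nonneg (truncFactor_pos (hpos t) w).le]
    exact truncFactor_le_one (hpos t) w
  have hz₁ : ‖rep z.1‖ ≤ R := (BoundedContinuousFunction.norm_le hR).2 fun x => by
    rw [rep_apply, value_toPhys_fst, trunc, Prod.smul_fst, map_smul, norm_smul]
    exact (mul_le_of_le_one_left (norm_nonneg _) hl).trans (hw₁ _)
  have hz₂ : ‖rep z.2‖ ≤ R := (BoundedContinuousFunction.norm_le hR).2 fun x => by
    rw [rep_apply, value_toPhys_snd, trunc, Prod.smul_snd, map_smul, norm_smul]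
    exact (mul_le_of_le_one_left (norm_nonneg _) hl).trans (hw₂ _)
  rw [norm_charField]
  have hC : 0 ≤ max C₁ C₂ := hC₁.trans (le_max_left _ _)
  refine max_le ?_ ?_
  · exact (H₁ z hz₁ hz₂).trans (mul_le_mul (le_max_left _ _) hz (norm_nonneg _) hC)
  · exact (H₂ z hz₁ hz₂).trans (mul_le_mul (le_max_right _ _) hz (norm_nonneg _) hC)

end Field

/-! ### Differentiation in moving frames and uniqueness. -/

/-- A product rule for translations, which are only strongly continuous. The curve splits as `(f s -
f t) + f t`: the first part needs only joint continuity of translation, the second only that the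
fixed value `f t` lies in `H¹`. -/
theorem hasDerivWithinAt_shift_comp {f : ℝ → L2} {f' : L2} {F : H1} {S : Set ℝ} {t : ℝ}
    (hf : HasDerivWithinAt f f' S t) (hF : f t = toL2 F) (σ : ℝ) :
    HasDerivWithinAt (fun s => NonlinearDirac.shift (σ * s) (f s))
      (NonlinearDirac.shift (σ * t) (f' + σ • dx F)) S t := by
  have h1 : HasDerivWithinAt (fun s => NonlinearDirac.shift (σ * s) (f s - f t))
      (NonlinearDirac.shift (σ * t) f') S t := by
    rw [hasDerivWithinAt_iff_tendsto_slope] at hf ⊢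
    have hσ : Filter.Tendsto (fun s : ℝ => σ * s) (𝓝[S \ {t}] t) (𝓝 (σ * t)) :=
      (continuous_const_mul σ).continuousAt.mono_left nhdsWithin_le_nhds
    refine ((NonlinearDirac.continuous_shift.tendsto (σ * t, f')).comp
      (hσ.prodMk_nhds hf)).congr fun s => ?_
    simp only [Function.comp_apply, slope_def_module, sub_self, map_zero, sub_zero]
    exact (NonlinearDirac.shift (σ * s)).toContinuousLinearMap.map_smul_of_tower (s - t)⁻¹ _
  have h2 : HasDerivAt (fun s => NonlinearDirac.shift (σ * s) (f t))
      (NonlinearDirac.shift (σ * t) (σ • dx F)) t := by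
    have hi : HasDerivAt (fun s => σ * (s - t)) σ t := by
      simpa using ((hasDerivAt_id' t).sub_const t).const_mul σ
    have h0 : HasDerivAt (fun s => NonlinearDirac.shift s (toL2 F)) (dx F) (σ * (t - t)) := by
      simpa using hasDerivAt_shift F
    have h3 := h0.scomp t hi
    have h4 := ((NonlinearDirac.shift (σ * t)).toContinuousLinearMap.restrictScalars ℝ).hasFDerivAt
      |>.comp_hasDerivAt t h3
    refine h4.congr_of_eventuallyEq (Filter.Eventually.of_forall fun s => ?_)
    simp only [Function.comp_apply, ContinuousLinearMap.coe_restrictScalars',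
      LinearIsometry.coe_toContinuousLinearMap, NonlinearDirac.shift_shift, hF]
    congr 2
    ring
  have h := h1.add h2.hasDerivWithinAt
  rw [map_add]
  refine h.congr_of_eventuallyEq (Filter.Eventually.of_forall fun s => ?_) ?_
  · simp
  · simp

theorem norm_sq_toL2 (f : L2) : ‖f‖ ^ 2 = ∫ x, ‖f x‖ ^ 2 := by
  have h : ((‖f‖ ^ 2 : ℝ) : ℂ) = ((∫ x, ‖f x‖ ^ 2 : ℝ) : ℂ) := by
    rw [← integral_complex_ofReal]
    have := L2.inner_def (𝕜 := ℂ) f f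
    rw [inner_self_eq_norm_sq_to_K] at this
    simpa [inner_self_eq_norm_sq_to_K] using this
  exact_mod_cast h

theorem intervalIntegral_value_sq_le (f : H1) {α β : ℝ} (h : α ≤ β) :
    ∫ x in α..β, ‖value x f‖ ^ 2 ≤ ‖toL2 f‖ ^ 2 := by
  have hi : Integrable fun x => ‖value x f‖ ^ 2 :=
    ((Lp.memLp (toL2 f)).integrable_norm_pow (by simp)).congr
      (by filter_upwards [value_ae_eq f] with x hx; rw [← hx])
  rw [norm_sq_toL2, intervalIntegral.integral_of_le h]
  refine (setIntegral_le_integral hi (Filter.Eventually.of_forall fun _ => by positivity)).trans ?_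
  refine (integral_congr_ae ?_).le
  filter_upwards [value_ae_eq f] with x hx
  rw [← hx]

theorem IsH1Curve.hasDerivWithinAt_shift {w : ℝ → ℝ → ℂ} {U : ℝ → H1} {U' : ℝ → L2}
    (h : IsH1Curve w U U') (σ : ℝ) {t : ℝ} (ht : t ∈ Ici (0 : ℝ)) :
    HasDerivWithinAt (fun s => NonlinearDirac.shift (σ * s) (toL2 (U s)))
      (NonlinearDirac.shift (σ * t) (U' t + σ • dx (U t))) (Ici 0) t :=
  hasDerivWithinAt_shift_comp (h.hasDeriv_L2 t ht) rfl σ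

theorem IsH1Curve.value_eq {w : ℝ → ℝ → ℂ} {U : ℝ → H1} {U' : ℝ → L2}
    (h : IsH1Curve w U U') {t : ℝ} (ht : t ∈ Ici (0 : ℝ)) : (fun x => value x (U t)) = w t :=
  funext fun x => value_eq_of_ae (h.continuous_rep t ht) (h.rep_ae_eq t ht) x

theorem IsLift.ae_eq {G : ℂ → ℂ → ℂ} {N : H1 × H1 → H1} (h : IsLift G N) (w : H1 × H1) :
    ∀ᵐ x : ℝ, toL2 (N w) x = G (value x w.1) (value x w.2) := by
  filter_upwards [value_ae_eq (N w)] with x hx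
  rw [← hx, h.value_eq]

theorem IsLift.eq_of_ae {G : ℂ → ℂ → ℂ} {N : H1 × H1 → H1} (h : IsLift G N) {w : H1 × H1}
    {f : L2} (hf : ∀ᵐ x : ℝ, Complex.I * f x = G (value x w.1) (value x w.2)) :
    f = (-Complex.I) • toL2 (N w) := by
  apply Lp.ext
  filter_upwards [hf, h.ae_eq w, Lp.coeFn_smul (-Complex.I) (toL2 (N w))] with x h1 h2 h3
  rw [h3, Pi.smul_apply, h2, ← h1, smul_eq_mul, ← mul_assoc]
  simp

/-- Classical solutions of a system whose nonlinearities act on `H¹` are unique. -/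
theorem IsGlobalClassicalSolution.unique {g₁ g₂ : ℂ → ℂ → ℂ} {N₁ N₂ : H1 × H1 → H1}
    (h₁ : IsLift g₁ N₁) (h₂ : IsLift g₂ N₂) {u₀ v₀ : ℝ → ℂ} {u v u' v' : ℝ → ℝ → ℂ}
    (h : IsGlobalClassicalSolution g₁ g₂ u₀ v₀ u v)
    (h' : IsGlobalClassicalSolution g₁ g₂ u₀ v₀ u' v') {T : ℝ} (hT : 0 ≤ T) :
    u' T = u T ∧ v' T = v T := by
  obtain ⟨U, V, Ut, Vt, hU, hV, eU, eV, hu0, hv0⟩ := h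
  obtain ⟨P, Q, Pt, Qt, hP, hQ, eP, eQ, hp0, hq0⟩ := h'
  have h0 : (0 : ℝ) ∈ Ici (0 : ℝ) := mem_Ici.2 le_rfl
  have field₁ : ∀ (w z : ℝ → ℝ → ℂ) (A B : ℝ → H1) (At Bt : ℝ → L2), IsH1Curve w A At →
      IsH1Curve z B Bt →
      (∀ t ∈ Ici (0 : ℝ), ∀ᵐ x : ℝ, Complex.I * (At t x + dx (A t) x) = g₁ (w t x) (z t x)) →
      ∀ t ∈ Ici (0 : ℝ), At t + (1 : ℝ) • dx (A t) = (-Complex.I) • toL2 (N₁ (A t, B t)) := by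
    intro w z A B At Bt hA hB e t ht
    refine h₁.eq_of_ae ?_
    rw [one_smul]
    filter_upwards [e t ht, Lp.coeFn_add (At t) (dx (A t))] with x h1 h2
    rw [h2, Pi.add_apply, h1, ← hA.value_eq ht, ← hB.value_eq ht]
  have field₂ : ∀ (w z : ℝ → ℝ → ℂ) (A B : ℝ → H1) (At Bt : ℝ → L2), IsH1Curve w A At →
      IsH1Curve z B Bt →
      (∀ t ∈ Ici (0 : ℝ), ∀ᵐ x : ℝ, Complex.I * (Bt t x - dx (B t) x) = g₂ (w t x) (z t x)) →
      ∀ t ∈ Ici (0 : ℝ), Bt t + (-1 : ℝ) • dx (B t) = (-Complex.I) • toL2 (N₂ (A t, B t)) := by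
    intro w z A B At Bt hA hB e t ht
    refine h₂.eq_of_ae ?_
    rw [neg_one_smul, ← sub_eq_add_neg]
    filter_upwards [e t ht, Lp.coeFn_sub (Bt t) (dx (B t))] with x h1 h2
    rw [h2, Pi.sub_apply, h1, ← hA.value_eq ht, ← hB.value_eq ht]
  have bound : ∀ {A : ℝ → H1}, ContinuousOn A (Ici 0) → ∃ C, ∀ t ∈ Icc 0 T, ‖A t‖ ≤ C :=
    fun hA => isCompact_Icc.exists_bound_of_continuousOn (hA.mono Icc_subset_Ici_self)
  obtain ⟨CU, hCU⟩ := bound hU.continuousOn_H1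
  obtain ⟨CV, hCV⟩ := bound hV.continuousOn_H1
  obtain ⟨CP, hCP⟩ := bound hP.continuousOn_H1
  obtain ⟨CQ, hCQ⟩ := bound hQ.continuousOn_H1
  set ρ := max (max CU CV) (max CP CQ)
  obtain ⟨K₁, hK₁, H₁⟩ := h₁.lipschitz_L2 ρ
  obtain ⟨K₂, hK₂, H₂⟩ := h₂.lipschitz_L2 ρ
  have hw : ∀ t ∈ Icc 0 T, ‖(U t, V t)‖ ≤ ρ := fun t ht =>
    (max_le_max (hCU t ht) (hCV t ht)).trans (le_max_left _ _)
  have hz : ∀ t ∈ Icc 0 T, ‖(P t, Q t)‖ ≤ ρ := fun t ht =>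
    (max_le_max (hCP t ht) (hCQ t ht)).trans (le_max_right _ _)
  -- The comparison is made in `L²`, where classical solutions are differentiable in time; moving
  -- each component along its characteristics removes the spatial derivative. The `H¹` bounds enter
  -- only through the Lipschitz constants.
  let D : ℝ → L2 × L2 := fun t =>
    (NonlinearDirac.shift (1 * t) (toL2 (U t)) - NonlinearDirac.shift (1 * t) (toL2 (P t)),
      NonlinearDirac.shift (-1 * t) (toL2 (V t)) - NonlinearDirac.shift (-1 * t) (toL2 (Q t)))
  let D' : ℝ → L2 × L2 := fun t =>
    (NonlinearDirac.shift (1 * t) (Ut t + (1 : ℝ) • dx (U t)) -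
        NonlinearDirac.shift (1 * t) (Pt t + (1 : ℝ) • dx (P t)),
      NonlinearDirac.shift (-1 * t) (Vt t + (-1 : ℝ) • dx (V t)) -
        NonlinearDirac.shift (-1 * t) (Qt t + (-1 : ℝ) • dx (Q t)))
  have hD : ∀ t ∈ Ici (0 : ℝ), HasDerivWithinAt D (D' t) (Ici 0) t := fun t ht =>
    ((hU.hasDerivWithinAt_shift 1 ht).sub (hP.hasDerivWithinAt_shift 1 ht)).prodMk
      ((hV.hasDerivWithinAt_shift (-1) ht).sub (hQ.hasDerivWithinAt_shift (-1) ht))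
  have hnorm : ∀ t, ‖D t‖ = max ‖toL2 (U t - P t)‖ ‖toL2 (V t - Q t)‖ := fun t => by
    simp only [D]
    rw [Prod.norm_mk, ← map_sub, ← map_sub, LinearIsometry.norm_map, LinearIsometry.norm_map]
    rfl
  have hI : ∀ f g : L2, ‖(-Complex.I) • f - (-Complex.I) • g‖ = ‖f - g‖ := fun f g => by
    rw [← smul_sub, norm_smul, norm_neg, Complex.norm_I, one_mul]
  have hnorm' : ∀ t ∈ Icc 0 T, ‖D' t‖ ≤ max K₁ K₂ * ‖D t‖ := fun t ht => by
    have ht' : t ∈ Ici (0 : ℝ) := ht.1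
    simp only [D']
    rw [Prod.norm_mk, ← map_sub, ← map_sub, LinearIsometry.norm_map, LinearIsometry.norm_map,
      field₁ u v U V Ut Vt hU hV eU t ht', field₁ u' v' P Q Pt Qt hP hQ eP t ht',
      field₂ u v U V Ut Vt hU hV eV t ht', field₂ u' v' P Q Pt Qt hP hQ eQ t ht',
      hI, hI, hnorm]
    refine max_le ?_ ?_
    · exact (H₁ _ _ (hw t ht) (hz t ht)).trans
        (mul_le_mul_of_nonneg_right (le_max_left _ _) (le_max_of_le_left (norm_nonneg _)))
    · exact (H₂ _ _ (hw t ht) (hz t ht)).trans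
        (mul_le_mul_of_nonneg_right (le_max_right _ _) (le_max_of_le_left (norm_nonneg _)))
  have eqL2 : ∀ {a b : ℝ → ℝ → ℂ} {A B : ℝ → H1} {At Bt : ℝ → L2}, IsH1Curve a A At →
      IsH1Curve b B Bt → a 0 = b 0 → toL2 (A 0) = toL2 (B 0) := by
    intro a b A B At Bt hA hB e
    apply Lp.ext
    filter_upwards [hA.rep_ae_eq 0 h0, hB.rep_ae_eq 0 h0] with x h1 h2
    rw [← h1, ← h2, e]
  have hD0 : D 0 = 0 := by
    simp only [D]
    rw [eqL2 hU hP (hu0.trans hp0.symm), eqL2 hV hQ (hv0.trans hq0.symm), sub_self, sub_self]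
    rfl
  have hzero := eq_zero_of_abs_deriv_le_mul_abs_self_of_eq_zero_right (f := D) (f' := D')
    (K := max K₁ K₂) (a := 0) (b := T)
    (fun t ht => ((hD t ht.1).continuousWithinAt).mono Icc_subset_Ici_self)
    (fun t ht => (hD t ht.1).mono (Ici_subset_Ici.2 ht.1)) hD0
    (fun t ht => hnorm' t (Ico_subset_Icc_self ht)) T ⟨hT, le_rfl⟩
  have hmax := hnorm T
  rw [hzero, norm_zero] at hmax
  have hT' : T ∈ Ici (0 : ℝ) := hT
  have hUP : U T = P T := by
    apply toL2_injective
    have : ‖toL2 (U T - P T)‖ ≤ 0 := hmax ▸ le_max_left _ _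
    exact sub_eq_zero.1 (norm_le_zero_iff.1 this)
  have hVQ : V T = Q T := by
    apply toL2_injective
    have : ‖toL2 (V T - Q T)‖ ≤ 0 := hmax ▸ le_max_right _ _
    exact sub_eq_zero.1 (norm_le_zero_iff.1 this)
  rw [← hU.value_eq hT', ← hV.value_eq hT', ← hP.value_eq hT', ← hQ.value_eq hT', hUP, hVQ]
  exact ⟨rfl, rfl⟩

/-! ### Return to physical coordinates. -/

theorem continuous_value_uncurry : Continuous fun p : ℝ × H1 => value p.1 p.2 := by
  have : (fun p : ℝ × H1 => value p.1 p.2) = fun p => value 0 (H1.shift p.1 p.2) := by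
    ext p; rw [value_shift, zero_add]
  rw [this]
  exact (value 0).continuous.comp H1.continuous_shift

theorem continuousOn_comp_prodMk {A X Y Z : Type*} [TopologicalSpace X]
    [TopologicalSpace Y] [TopologicalSpace Z] [TopologicalSpace A] {Φ : Z × X → Y}
    (hΦ : Continuous Φ) {φ : A → Z} {U : A → X} {S : Set A} (hφ : ContinuousOn φ S)
    (hU : ContinuousOn U S) : ContinuousOn (fun t => Φ (φ t, U t)) S :=
  hΦ.comp_continuousOn (hφ.prodMk hU)

theorem continuousOn_value {A : Type*} [TopologicalSpace A] {φ : A → ℝ} {U : A → H1} {S : Set A}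
    (hφ : ContinuousOn φ S) (hU : ContinuousOn U S) :
    ContinuousOn (fun t => value (φ t) (U t)) S :=
  continuousOn_comp_prodMk (Φ := fun p : ℝ × H1 => value p.1 p.2)
    continuous_value_uncurry hφ hU

theorem continuousOn_toPhys {w : ℝ → H1 × H1} {S : Set ℝ} (hw : ContinuousOn w S) :
    ContinuousOn (fun t => toPhys t (w t)) S :=
  continuousOn_comp_prodMk (Φ := fun p : ℝ × (H1 × H1) => toPhys p.1 p.2)
    continuous_toPhys continuousOn_id hw

theorem continuousOn_smul_sub {X : Type*} [NormedAddCommGroup X] [NormedSpace ℂ X] (c : ℂ)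
    {f g : ℝ → X} {S : Set ℝ} (hf : ContinuousOn f S) (hg : ContinuousOn g S) :
    ContinuousOn (fun t => c • f t - g t) S := (hf.const_smul c).sub hg

theorem continuousOn_smul_add {X : Type*} [NormedAddCommGroup X] [NormedSpace ℂ X] (c : ℂ)
    {f g : ℝ → X} {S : Set ℝ} (hf : ContinuousOn f S) (hg : ContinuousOn g S) :
    ContinuousOn (fun t => c • f t + g t) S := (hf.const_smul c).add hg

theorem continuousOn_dx {U : ℝ → H1} {S : Set ℝ} (hU : ContinuousOn U S) :
    ContinuousOn (fun t => dx (U t)) S := continuous_dx.comp_continuousOn hU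

/-- The data of a solution in characteristic coordinates yields a classical solution. -/
theorem isGlobalClassicalSolution_of_charField {g₁ g₂ : ℂ → ℂ → ℂ} {N₁ N₂ : H1 × H1 → H1}
    (h₁ : IsLift g₁ N₁) (h₂ : IsLift g₂ N₂) {w : ℝ → H1 × H1}
    (hw : ∀ t ∈ Ici (0 : ℝ), HasDerivWithinAt w
      ((-Complex.I) • toPhys (-t) (N₁ (toPhys t (w t)), N₂ (toPhys t (w t)))) (Ici 0) t) :
    IsGlobalClassicalSolution g₁ g₂ (fun x => value x (w 0).1) (fun x => value x (w 0).2)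
      (fun t x => value x (toPhys t (w t)).1) (fun t x => value x (toPhys t (w t)).2) := by
  have hwc : ContinuousOn w (Ici 0) := fun t ht => (hw t ht).continuousWithinAt
  have hz : ContinuousOn (fun t => toPhys t (w t)) (Ici 0) := continuousOn_toPhys hwc
  have hN₁ : ContinuousOn (fun t => toL2 (N₁ (toPhys t (w t)))) (Ici 0) :=
    (continuous_toL2.comp h₁.continuous).comp_continuousOn hz
  have hN₂ : ContinuousOn (fun t => toL2 (N₂ (toPhys t (w t)))) (Ici 0) :=
    (continuous_toL2.comp h₂.continuous).comp_continuousOn hz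
  have hd₁ : ∀ t ∈ Ici (0 : ℝ), HasDerivWithinAt (fun s => toL2 (toPhys s (w s)).1)
      ((-Complex.I) • toL2 (N₁ (toPhys t (w t))) - dx (toPhys t (w t)).1) (Ici 0) t := by
    intro t ht
    have h := ((toL2L.comp (ContinuousLinearMap.fst ℂ H1 H1)).restrictScalars ℝ).hasFDerivAt
      |>.comp_hasDerivWithinAt t (hw t ht)
    have h' := hasDerivWithinAt_shift_comp (F := (w t).1) h rfl (-1)
    have e : NonlinearDirac.shift (-1 * t)
          (((toL2L.comp (ContinuousLinearMap.fst ℂ H1 H1)).restrictScalars ℝ)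
          ((-Complex.I) • toPhys (-t) (N₁ (toPhys t (w t)), N₂ (toPhys t (w t)))) +
          (-1 : ℝ) • dx (w t).1) =
        (-Complex.I) • toL2 (N₁ (toPhys t (w t))) - dx (toPhys t (w t)).1 := by
      rw [map_add, neg_one_smul, map_neg, ← sub_eq_add_neg, neg_one_mul]
      congr 1
      simp only [ContinuousLinearMap.coe_restrictScalars', ContinuousLinearMap.comp_apply,
        ContinuousLinearMap.coe_fst', map_smul, toL2L_apply]
      congr 1
      conv_lhs => rw [toPhys, toL2_shift, NonlinearDirac.shift_shift, neg_neg, neg_add_cancel,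
        NonlinearDirac.shift_zero]
    rw [e] at h'
    refine h'.congr_of_eventuallyEq (Filter.Eventually.of_forall fun s => ?_) ?_ <;>
    simp [toPhys]
  have hd₂ : ∀ t ∈ Ici (0 : ℝ), HasDerivWithinAt (fun s => toL2 (toPhys s (w s)).2)
      ((-Complex.I) • toL2 (N₂ (toPhys t (w t))) + dx (toPhys t (w t)).2) (Ici 0) t := by
    intro t ht
    have h := ((toL2L.comp (ContinuousLinearMap.snd ℂ H1 H1)).restrictScalars ℝ).hasFDerivAt
      |>.comp_hasDerivWithinAt t (hw t ht)
    have h' := hasDerivWithinAt_shift_comp (F := (w t).2) h rfl 1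
    have e : NonlinearDirac.shift (1 * t)
          (((toL2L.comp (ContinuousLinearMap.snd ℂ H1 H1)).restrictScalars ℝ)
          ((-Complex.I) • toPhys (-t) (N₁ (toPhys t (w t)), N₂ (toPhys t (w t)))) +
          (1 : ℝ) • dx (w t).2) =
        (-Complex.I) • toL2 (N₂ (toPhys t (w t))) + dx (toPhys t (w t)).2 := by
      rw [map_add, one_smul, one_mul]
      congr 1
      simp only [ContinuousLinearMap.coe_restrictScalars', ContinuousLinearMap.comp_apply,
        ContinuousLinearMap.coe_snd', map_smul, toL2L_apply]
      congr 1
      conv_lhs => rw [toPhys, toL2_shift, NonlinearDirac.shift_shift, add_neg_cancel,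
        NonlinearDirac.shift_zero]
    rw [e] at h'
    refine h'.congr_of_eventuallyEq (Filter.Eventually.of_forall fun s => ?_) ?_ <;>
    simp [toPhys]
  have hI : ∀ z : ℂ, Complex.I * (-Complex.I * z) = z := fun z => by
    rw [← mul_assoc, mul_neg, Complex.I_mul_I, neg_neg, one_mul]
  refine ⟨fun t => (toPhys t (w t)).1, fun t => (toPhys t (w t)).2,
    fun t => (-Complex.I) • toL2 (N₁ (toPhys t (w t))) - dx (toPhys t (w t)).1,
    fun t => (-Complex.I) • toL2 (N₂ (toPhys t (w t))) + dx (toPhys t (w t)).2, ?_, ?_, ?_, ?_,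
    ?_, ?_⟩
  · exact ⟨hz.fst, hd₁, continuousOn_smul_sub _ hN₁ (continuousOn_dx hz.fst),
      fun t _ => continuous_value _, fun t _ => value_ae_eq _⟩
  · exact ⟨hz.snd, hd₂, continuousOn_smul_add _ hN₂ (continuousOn_dx hz.snd),
      fun t _ => continuous_value _, fun t _ => value_ae_eq _⟩
  · intro t _
    filter_upwards [h₁.ae_eq (toPhys t (w t)), Lp.coeFn_smul (-Complex.I)
      (toL2 (N₁ (toPhys t (w t)))), Lp.coeFn_sub ((-Complex.I) • toL2 (N₁ (toPhys t (w t))))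
      (dx (toPhys t (w t)).1)] with x h1 h2 h3
    rw [h3, Pi.sub_apply, sub_add_cancel, h2, Pi.smul_apply, smul_eq_mul, hI, h1]
  · intro t _
    filter_upwards [h₂.ae_eq (toPhys t (w t)), Lp.coeFn_smul (-Complex.I)
      (toL2 (N₂ (toPhys t (w t)))), Lp.coeFn_add ((-Complex.I) • toL2 (N₂ (toPhys t (w t))))
      (dx (toPhys t (w t)).2)] with x h1 h2 h3
    rw [h3, Pi.add_apply, add_sub_cancel_right, h2, Pi.smul_apply, smul_eq_mul, hI, h1]
  · simp [toPhys_zero]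
  · simp [toPhys_zero]

theorem memLinfty_of_bound {U : ℝ → H1} (hU : ContinuousOn U (Ici 0)) {C : ℝ}
    (hC : ∀ t ∈ Ici (0 : ℝ), ∀ x, ‖value x (U t)‖ ≤ C) : MemLinfty fun t x => value x (U t) := by
  have hm : MeasurableSet (Ici (0 : ℝ) ×ˢ (univ : Set ℝ)) := measurableSet_Ici.prod .univ
  have hc : ContinuousOn (fun p : ℝ × ℝ => value p.2 (U p.1)) (Ici (0 : ℝ) ×ˢ (univ : Set ℝ)) :=
    continuousOn_value continuousOn_snd (hU.comp continuousOn_fst fun p hp => hp.1)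
  refine memLp_top_of_bound (hc.aestronglyMeasurable hm) C ?_
  filter_upwards [ae_restrict_mem hm] with p hp
  exact hC _ hp.1 _

theorem exists_H1_of_memH1 {f : ℝ → ℂ} (hf : MemH1 f) : ∃ g : H1, f = fun x => value x g := by
  obtain ⟨hc, g, hg⟩ := hf
  exact ⟨g, funext fun x => (value_eq_of_ae hc hg x).symm⟩

/-! ### A priori bounds and removal of the truncation. -/

theorem norm_toL2_le_of_eLpNorm_le {g : H1} {δ : ℝ} (hδ : 0 ≤ δ)
    (h : eLpNorm (fun x => value x g) 2 volume ≤ ENNReal.ofReal δ) : ‖toL2 g‖ ≤ δ := by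
  rw [eLpNorm_congr_ae (value_ae_eq g)] at h
  rw [Lp.norm_def]
  exact ENNReal.toReal_le_of_le_ofReal hδ h

theorem integral_value_add_mul_le (f : H1) (y : ℝ) {t : ℝ} (ht : 0 ≤ t) :
    ∫ s in (0:ℝ)..t, ‖value (y + 2 * s) f‖ ^ 2 ≤ ‖toL2 f‖ ^ 2 / 2 := by
  rw [intervalIntegral.integral_comp_add_mul (fun x => ‖value x f‖ ^ 2) two_ne_zero y,
    smul_eq_mul]
  rw [div_eq_inv_mul]
  exact mul_le_mul_of_nonneg_left (intervalIntegral_value_sq_le f (by linarith)) (by norm_num)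

theorem integral_value_sub_mul_le (f : H1) (y : ℝ) {t : ℝ} (ht : 0 ≤ t) :
    ∫ s in (0:ℝ)..t, ‖value (y - 2 * s) f‖ ^ 2 ≤ ‖toL2 f‖ ^ 2 / 2 := by
  rw [intervalIntegral.integral_comp_sub_mul (fun x => ‖value x f‖ ^ 2) two_ne_zero y,
    smul_eq_mul]
  rw [div_eq_inv_mul]
  exact mul_le_mul_of_nonneg_left (intervalIntegral_value_sq_le f (by linarith)) (by norm_num)

theorem hasDerivWithinAt_value_fst {w : ℝ → H1 × H1} {w' : H1 × H1} {t : ℝ}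
    (h : HasDerivWithinAt w w' (Ici 0) t) (y : ℝ) :
    HasDerivWithinAt (fun s => value y (w s).1) (value y w'.1) (Ici 0) t :=
  (((value y).comp (ContinuousLinearMap.fst ℂ H1 H1)).restrictScalars ℝ).hasFDerivAt
    |>.comp_hasDerivWithinAt t h

theorem hasDerivWithinAt_value_snd {w : ℝ → H1 × H1} {w' : H1 × H1} {t : ℝ}
    (h : HasDerivWithinAt w w' (Ici 0) t) (y : ℝ) :
    HasDerivWithinAt (fun s => value y (w s).2) (value y w'.2) (Ici 0) t :=
  (((value y).comp (ContinuousLinearMap.snd ℂ H1 H1)).restrictScalars ℝ).hasFDerivAt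
    |>.comp_hasDerivWithinAt t h

/-- Along characteristics, solutions of the truncated system with small initial mass grow at most
by a fixed factor. -/
theorem norm_sq_le_two_mul_of_charField {W : ℂ → ℂ → ℝ} {F₁ F₂ : ℂ → ℂ → ℂ} {c μ : ℝ}
    {N₁ N₂ : H1 × H1 → H1} {ρ : ℝ → ℝ} (hc : 0 ≤ c) (hμ : 0 < μ)
    (hcμ : Real.exp (2 * c * (2 * μ)) ≤ 2) (hW : IsPolynomialInModuli W)
    (hF : ∀ u v : ℂ, ‖star u * F₁ u v‖ + ‖star v * F₂ u v‖ ≤ c * ‖u‖ ^ 2 * ‖v‖ ^ 2)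
    (h₁ : IsLift (G₁ W F₁) N₁) (h₂ : IsLift (G₂ W F₂) N₂) (hpos : ∀ t, 0 < ρ t)
    {w : ℝ → H1 × H1} (hw : ∀ t ∈ Ici (0 : ℝ),
      HasDerivWithinAt w (charField N₁ N₂ ρ t (w t)) (Ici 0) t)
    (hm₁ : ‖toL2 (w 0).1‖ ^ 2 ≤ μ) (hm₂ : ‖toL2 (w 0).2‖ ^ 2 ≤ μ) {t : ℝ} (ht : 0 ≤ t) (y : ℝ) :
    ‖value y (w t).1‖ ^ 2 ≤ 2 * ‖value y (w 0).1‖ ^ 2 ∧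
      ‖value y (w t).2‖ ^ 2 ≤ 2 * ‖value y (w 0).2‖ ^ 2 := by
  obtain ⟨Q₁, Q₂, hQ₁, hQ₂⟩ := wirtingerBar_polynomialInModuli hW
  have hwc : ContinuousOn w (Ici 0) := fun t ht => (hw t ht).continuousWithinAt
  refine transport_le_two_mul hc hμ hcμ (a := fun t y => ‖value y (w t).1‖ ^ 2)
    (b := fun t y => ‖value y (w t).2‖ ^ 2) (fun _ _ => by positivity) (fun _ _ => by positivity)
    (fun y t ht => (hasDerivWithinAt_value_fst (hw t ht) y).norm_sq)
    (fun y t ht => (hasDerivWithinAt_value_snd (hw t ht) y).norm_sq)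
    (fun y t ht => ?_) (fun y t ht => ?_) (fun y => ?_) (fun y => ?_) (fun T => ?_)
    (fun y => ?_) (fun y => ?_)
    (fun y t ht => (integral_value_add_mul_le _ y ht).trans (by linarith))
    (fun y t ht => (integral_value_sub_mul_le _ y ht).trans (by linarith)) ht y
  · rw [value_charField_fst h₁, G₁, hQ₁]
    refine two_mul_inner_le (truncFactor_pos (hpos t) _) (truncFactor_le_one (hpos t) _) ?_ hc
    exact (le_add_of_nonneg_right (norm_nonneg _)).trans (hF _ _)
  · rw [value_charField_snd h₂, G₂, hQ₂]
    refine two_mul_inner_le (truncFactor_pos (hpos t) _) (truncFactor_le_one (hpos t) _) ?_ hc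
    rw [mul_right_comm]
    exact (le_add_of_nonneg_left (norm_nonneg _)).trans (hF _ _)
  · exact (continuousOn_value (by fun_prop) hwc.snd).norm.pow 2
  · exact (continuousOn_value (by fun_prop) hwc.fst).norm.pow 2
  · obtain ⟨K, hK⟩ := (isCompact_Icc (a := (0:ℝ)) (b := T)).exists_bound_of_continuousOn
      (hwc.mono Icc_subset_Ici_self)
    have key : ∀ (f : H1) (y : ℝ), ‖f‖ ≤ K → ‖value y f‖ ^ 2 ≤ (embConst * K) ^ 2 :=
      fun f y hf => pow_le_pow_left₀ (norm_nonneg _)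
        ((norm_value_le y f).trans (mul_le_mul_of_nonneg_left hf embConst_nonneg)) 2
    exact ⟨(embConst * K) ^ 2, fun t ht y =>
      ⟨key _ _ ((norm_fst_le _).trans (hK t ht)), key _ _ ((norm_snd_le _).trans (hK t ht))⟩⟩
  · exact ((continuous_value _).comp (by fun_prop : Continuous fun s : ℝ => y + 2 * s)).norm.pow 2
  · exact ((continuous_value _).comp (by fun_prop : Continuous fun s : ℝ => y - 2 * s)).norm.pow 2

theorem norm_le_two_mul_of_sq_le {a b : ℝ} (hb : 0 ≤ b) (h : a ^ 2 ≤ 2 * b ^ 2) :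
    a ≤ 2 * b := by
  nlinarith [sq_nonneg b]

/-- Existence in characteristic coordinates of an untruncated solution satisfying the pointwise
bound along characteristics. -/
theorem exists_charSolution {W : ℂ → ℂ → ℝ} {F₁ F₂ : ℂ → ℂ → ℂ} {c μ : ℝ}
    {N₁ N₂ : H1 × H1 → H1} (hc : 0 ≤ c) (hμ : 0 < μ)
    (hcμ : Real.exp (2 * c * (2 * μ)) ≤ 2) (hW : IsPolynomialInModuli W)
    (hF : ∀ u v : ℂ, ‖star u * F₁ u v‖ + ‖star v * F₂ u v‖ ≤ c * ‖u‖ ^ 2 * ‖v‖ ^ 2)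
    (h₁ : IsLift (G₁ W F₁) N₁) (h₂ : IsLift (G₂ W F₂) N₂) (w₀ : H1 × H1)
    (hm₁ : ‖toL2 w₀.1‖ ^ 2 ≤ μ) (hm₂ : ‖toL2 w₀.2‖ ^ 2 ≤ μ) :
    ∃ w : ℝ → H1 × H1, w 0 = w₀ ∧
      (∀ t ∈ Ici (0 : ℝ), HasDerivWithinAt w
        ((-Complex.I) • toPhys (-t) (N₁ (toPhys t (w t)), N₂ (toPhys t (w t)))) (Ici 0) t) ∧
      ∀ t, 0 ≤ t → ∀ y, ‖value y (w t).1‖ ^ 2 ≤ 2 * ‖value y w₀.1‖ ^ 2 ∧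
        ‖value y (w t).2‖ ^ 2 ≤ 2 * ‖value y w₀.2‖ ^ 2 := by
  -- This bounds the sup norm at all times, since squared moduli at most double. It depends on the
  -- data alone, so `C` can be fixed before `ρ` without circularity.
  set R := 2 * (embConst * ‖w₀‖)
  obtain ⟨C₁, hC₁, H₁⟩ := h₁.tame R
  obtain ⟨C₂, hC₂, H₂⟩ := h₂.tame R
  set C := max C₁ C₂
  have hC : 0 ≤ C := hC₁.trans (le_max_left _ _)
  -- The radius lies above the Gronwall bound `‖w₀‖ exp (C t)`; adding 1 keeps it positive when the
  -- data vanish.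
  set ρ : ℝ → ℝ := fun t => (‖w₀‖ + 1) * Real.exp (C * t)
  have hpos : ∀ t, 0 < ρ t := fun t => by positivity
  have hρ : Continuous ρ := by fun_prop
  have hmono : Monotone ρ := fun s t hst => by
    refine mul_le_mul_of_nonneg_left (Real.exp_le_exp.2 ?_) (by positivity)
    exact mul_le_mul_of_nonneg_left hst hC
  obtain ⟨w, hw0, hw⟩ := exists_truncated_solution h₁ h₂ hρ hmono hpos w₀
  have hb : ∀ t, 0 ≤ t → ∀ y, ‖value y (w t).1‖ ^ 2 ≤ 2 * ‖value y w₀.1‖ ^ 2 ∧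
        ‖value y (w t).2‖ ^ 2 ≤ 2 * ‖value y w₀.2‖ ^ 2 := fun t ht y => by
    have := norm_sq_le_two_mul_of_charField hc hμ hcμ hW hF h₁ h₂ hpos hw (by rwa [hw0])
      (by rwa [hw0]) ht y
    rwa [hw0] at this
  have hR : ∀ t, 0 ≤ t → ∀ y, ‖value y (w t).1‖ ≤ R ∧ ‖value y (w t).2‖ ≤ R := by
    intro t ht y
    have key : ∀ f : H1, ‖f‖ ≤ ‖w₀‖ → 2 * ‖value y f‖ ≤ R := fun f hf =>
      mul_le_mul_of_nonneg_left ((norm_value_le y f).trans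
        (mul_le_mul_of_nonneg_left hf embConst_nonneg)) zero_le_two
    exact ⟨(norm_le_two_mul_of_sq_le (norm_nonneg _) (hb t ht y).1).trans
        (key _ (norm_fst_le _)),
      (norm_le_two_mul_of_sq_le (norm_nonneg _) (hb t ht y).2).trans (key _ (norm_snd_le _))⟩
  have hn : ∀ t, 0 ≤ t → ‖w t‖ ≤ ρ t := by
    intro t ht
    have := norm_le_gronwallBound_of_norm_deriv_right_le (f := w)
      (f' := fun t => charField N₁ N₂ ρ t (w t)) (δ := ‖w₀‖) (K := C) (ε := 0) (a := 0) (b := t)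
      (fun s hs => ((hw s hs.1).continuousWithinAt).mono Icc_subset_Ici_self)
      (fun s hs => (hw s hs.1).mono (Ici_subset_Ici.2 hs.1)) (by rw [hw0])
      (fun s hs => by
        rw [add_zero]
        exact norm_charField_le hpos hC₁ H₁ H₂ (fun y => (hR s hs.1 y).1)
          (fun y => (hR s hs.1 y).2)) t ⟨ht, le_rfl⟩
    rw [gronwallBound_ε0, sub_zero] at this
    refine this.trans (mul_le_mul_of_nonneg_right (by linarith) (Real.exp_pos _).le)
  refine ⟨w, hw0, fun t ht => ?_, hb⟩
  have h := hw t ht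
  rwa [charField, trunc_eq_self (hpos t) (hn t ht)] at h

theorem apply_zero_of_cubic_bound {F₁ F₂ : ℂ → ℂ → ℂ} {c : ℝ} (h1 : IsCubicPolynomial F₁)
    (h2 : IsCubicPolynomial F₂)
    (hF : ∀ u v : ℂ, ‖star u * F₁ u v‖ + ‖star v * F₂ u v‖ ≤ c * ‖u‖ ^ 2 * ‖v‖ ^ 2) :
    F₁ 0 0 = 0 ∧ F₂ 0 0 = 0 := by
  constructor
  · refine eq_zero_of_mul_bound (f := fun u => F₁ u 0) (c := c)
      (h1.continuous.comp (by fun_prop : Continuous fun u : ℂ => (u, (0:ℂ)))) fun u => ?_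
    have := hF u 0
    rw [norm_mul, norm_star] at this
    exact (le_add_of_nonneg_right (norm_nonneg _)).trans this
  · refine eq_zero_of_mul_bound (f := fun v => F₂ 0 v) (c := c)
      (h2.continuous.comp (by fun_prop : Continuous fun v : ℂ => ((0:ℂ), v))) fun v => ?_
    have := hF 0 v
    rw [norm_mul (star v), norm_star v, mul_right_comm] at this
    exact (le_add_of_nonneg_left (norm_nonneg _)).trans this

end NonlinearDirac

end

/-! ### The proposition. -/

theorem proposition2p1 (c : ℝ) (hc : 0 < c) :
    ∃ δ : ℝ, 0 < δ ∧ ∃ C₂ : ℝ, 0 < C₂ ∧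
      ∀ (W : ℂ → ℂ → ℝ) (F₁ F₂ : ℂ → ℂ → ℂ),
        IsPolynomialInModuli W → IsCubicPolynomial F₁ → IsCubicPolynomial F₂ →
        (∀ u v : ℂ, ‖star u * F₁ u v‖ + ‖star v * F₂ u v‖ ≤ c * ‖u‖ ^ 2 * ‖v‖ ^ 2) →
        ∀ u₀ v₀ : ℝ → ℂ, MemH1 u₀ → MemH1 v₀ →
          eLpNorm u₀ 2 volume + eLpNorm v₀ 2 volume ≤ ENNReal.ofReal δ →
          ∃ u v : ℝ → ℝ → ℂ,
            IsGlobalClassicalSolution (G₁ W F₁) (G₂ W F₂) u₀ v₀ u v ∧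
            MemLinfty u ∧ MemLinfty v ∧
            (∀ u' v' : ℝ → ℝ → ℂ,
              IsGlobalClassicalSolution (G₁ W F₁) (G₂ W F₂) u₀ v₀ u' v' →
              ∀ t : ℝ, 0 ≤ t → u' t = u t ∧ v' t = v t) ∧
            (∀ t : ℝ, 0 ≤ t → ∀ x : ℝ,
              ‖u t x‖ ^ 2 + ‖v t x‖ ^ 2 ≤ C₂ * ⨆ y : ℝ, (‖u₀ y‖ ^ 2 + ‖v₀ y‖ ^ 2)) ∧
            (∀ t : ℝ, 0 ≤ t → ∀ a b : ℝ, a < b →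
              ∫ x in a..b, (‖u t x‖ ^ 2 + ‖v t x‖ ^ 2) ≤
                C₂ * ∫ x in a..b, (‖u₀ (x - t)‖ ^ 2 + ‖v₀ (x + t)‖ ^ 2)) := by
  -- Chosen so that `exp (4 c μ) = 2`; since `μ` bounds squared `L²` norms, `δ` is its square root.
  set μ : ℝ := Real.log 2 / (4 * c)
  have hμ : 0 < μ := div_pos (Real.log_pos one_lt_two) (by positivity)
  have hcμ : Real.exp (2 * c * (2 * μ)) ≤ 2 := by
    have : 2 * c * (2 * μ) = Real.log 2 := by
      simp only [μ]; field_simp; ring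
    rw [this, Real.exp_log two_pos]
  refine ⟨√μ, Real.sqrt_pos.2 hμ, 4, by norm_num, ?_⟩
  intro W F₁ F₂ hW hF₁ hF₂ hF u₀ v₀ hu₀ hv₀ hδ
  obtain ⟨f, rfl⟩ := exists_H1_of_memH1 hu₀
  obtain ⟨g, rfl⟩ := exists_H1_of_memH1 hv₀
  have hμsq : √μ ^ 2 = μ := Real.sq_sqrt hμ.le
  have hf : ‖H1.toL2 f‖ ^ 2 ≤ μ := by
    rw [← hμsq]
    exact pow_le_pow_left₀ (norm_nonneg _)
      (norm_toL2_le_of_eLpNorm_le (Real.sqrt_nonneg _) (le_self_add.trans hδ)) 2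
  have hg : ‖H1.toL2 g‖ ^ 2 ≤ μ := by
    rw [← hμsq]
    exact pow_le_pow_left₀ (norm_nonneg _)
      (norm_toL2_le_of_eLpNorm_le (Real.sqrt_nonneg _) (le_add_self.trans hδ)) 2
  obtain ⟨hF₁0, hF₂0⟩ := apply_zero_of_cubic_bound hF₁ hF₂ hF
  obtain ⟨Q₁, Q₂, hQ₁, hQ₂⟩ := wirtingerBar_polynomialInModuli hW
  obtain ⟨N₁, h₁⟩ := exists_isLift_of_eq (Q := Q₁) hF₁ 0 (G := G₁ W F₁)
    (fun u v => by rw [G₁, hQ₁]; rfl) hF₁0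
  obtain ⟨N₂, h₂⟩ := exists_isLift_of_eq (Q := Q₂) hF₂ 1 (G := G₂ W F₂)
    (fun u v => by rw [G₂, hQ₂]; rfl) hF₂0
  obtain ⟨w, hw0, hw, hb⟩ := exists_charSolution hc.le hμ hcμ hW hF h₁ h₂ (f, g) hf hg
  have hsol := isGlobalClassicalSolution_of_charField h₁ h₂ hw
  rw [hw0] at hsol
  have hbu : ∀ t, 0 ≤ t → ∀ x, ‖H1.value x (toPhys t (w t)).1‖ ^ 2 ≤
      2 * ‖H1.value (x - t) f‖ ^ 2 := fun t ht x => by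
    rw [value_toPhys_fst]; exact (hb t ht _).1
  have hbv : ∀ t, 0 ≤ t → ∀ x, ‖H1.value x (toPhys t (w t)).2‖ ^ 2 ≤
      2 * ‖H1.value (x + t) g‖ ^ 2 := fun t ht x => by
    rw [value_toPhys_snd]; exact (hb t ht _).2
  have hz : ContinuousOn (fun t => toPhys t (w t)) (Ici 0) :=
    continuousOn_toPhys fun t ht => (hw t ht).continuousWithinAt
  refine ⟨_, _, hsol, ?_, ?_, fun u' v' h' t ht => hsol.unique h₁ h₂ h' ht, ?_, ?_⟩
  · exact memLinfty_of_bound hz.fst (C := 2 * (H1.embConst * ‖f‖)) fun t ht x =>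
      (norm_le_two_mul_of_sq_le (norm_nonneg _) (hbu t ht x)).trans
        (mul_le_mul_of_nonneg_left (H1.norm_value_le _ _) zero_le_two)
  · exact memLinfty_of_bound hz.snd (C := 2 * (H1.embConst * ‖g‖)) fun t ht x =>
      (norm_le_two_mul_of_sq_le (norm_nonneg _) (hbv t ht x)).trans
        (mul_le_mul_of_nonneg_left (H1.norm_value_le _ _) zero_le_two)
  · intro t ht x
    have hbdd : BddAbove (range fun y => ‖H1.value y f‖ ^ 2 + ‖H1.value y g‖ ^ 2) := by
      refine ⟨(H1.embConst * ‖f‖) ^ 2 + (H1.embConst * ‖g‖) ^ 2, ?_⟩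
      rintro _ ⟨y, rfl⟩
      exact add_le_add (pow_le_pow_left₀ (norm_nonneg _) (H1.norm_value_le _ _) 2)
        (pow_le_pow_left₀ (norm_nonneg _) (H1.norm_value_le _ _) 2)
    -- The components trace back to different points `x - t` and `x + t`, each costing twice the
    -- supremum; hence `C₂ = 4`.
    have e1 := le_ciSup hbdd (x - t)
    have e2 := le_ciSup hbdd (x + t)
    have e3 := hbu t ht x
    have e4 := hbv t ht x
    have e5 := sq_nonneg ‖H1.value (x - t) g‖
    have e6 := sq_nonneg ‖H1.value (x + t) f‖
    simp only at e1 e2 ⊢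
    linarith
  · intro t ht a b hab
    have c1 : ∀ h : H1, Continuous fun x => ‖H1.value x h‖ ^ 2 := fun h =>
      (H1.continuous_value h).norm.pow 2
    have i1 : Continuous fun x => ‖H1.value x (toPhys t (w t)).1‖ ^ 2 +
        ‖H1.value x (toPhys t (w t)).2‖ ^ 2 := (c1 _).add (c1 _)
    have i2 : Continuous fun x => ‖H1.value (x - t) f‖ ^ 2 + ‖H1.value (x + t) g‖ ^ 2 :=
      ((c1 f).comp (continuous_id.sub continuous_const)).add
        ((c1 g).comp (continuous_id.add continuous_const))
    rw [← intervalIntegral.integral_const_mul]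
    refine intervalIntegral.integral_mono_on hab.le (i1.intervalIntegrable _ _)
      ((i2.const_mul 4).intervalIntegrable _ _) fun x _ => ?_
    have e3 := hbu t ht x
    have e4 := hbv t ht x
    have e5 := sq_nonneg ‖H1.value (x - t) f‖
    have e6 := sq_nonneg ‖H1.value (x + t) g‖
    linarith
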